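/- Let $d,M\ge 1$. For each $n\in\mathbb N$ let $W_n\subset\mathbb R^d$ be a bounded Borel set, $a_n>0$, and let $X_n$ be a (simple, locally finite) point process on $\mathbb R^d$ with intensity function $\lambda_n=a_n\lambda$, where $\lambda=f\circ z$ for measurable functions $z:\mathbb R^d\to\mathbb R$ and $f:\mathbb R\to[0,\infty)$, with $f$ bounded. Let $X_n$ have a pair correlation function $g_n$ such that, for some $c>0$, $a_n\int_{A\times A}|g_n(u,v)-1|\,du\,dv\le c|A|$ for all $n$ and all Borel $A\subset W_n$. (Here $g_n=\lambda_n^{(2)}/(\lambda_n\otimes\lambda_n)$, with $\lambda_n^{(2)}$ the second order intensity function, wherever the denominator is non-zero; elsewhere $g_n$ may take any values.) Let $x\in\mathbb R^d$ satisfy $z(x)\in z(W_n)$ for all $n$, and let $f$ be continuous and pointwise $\beta$-Hölder at $z(x)$ for some $\beta>0$, i.e. $f(y)-f(z(x))=O(|y-z(x)|^\beta)$ as $y\to z(x)$. Assume that $z$ is binary, i.e. $z(W_n)=\{0,1\}$ for all $n$, that $z$ is continuous at $x$, and that for some $c>0$, $|z^{-1}(z(x))\cap W_n|>c\,|W_n|$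 for all $n$. For a map $\zeta$ on $\mathbb R^d$ and partitions $\pi_n^{(1)},\dots,\pi_n^{(M)}$ of $\zeta(W_n)$ let $I_n^{(i)}(x)$ be the cell of $\pi_n^{(i)}$ that contains $\zeta(x)$, $A_n^{(i)}(x)=\zeta^{-1}(I_n^{(i)}(x))\cap W_n$, and $$\hat\lambda^{(RF)}(x)=\frac1M\sum_{i=1}^M\frac{\#(X_n\cap A_n^{(i)}(x))}{a_n|A_n^{(i)}(x)|}.$$ 1. (Partitions of $W_n$; $\zeta=\mathrm{id}$.) Assume that some ball $B(x,r)$, $r>0$, is contained in $W_n$ for all $n$. Let $h_n>0$ satisfy $h_n<a_n^{-\varepsilon}$ for all $n$, for some $\varepsilon>0$. For each $n$ let $T_n^{(1)},\dots,T_n^{(M)}$ be i.i.d. random tessellations of $\mathbb R^d$ (locally finite coverings by non-overlapping compact convex polytopes with non-empty interior), independent of $X_n$, that are stationary with intensity $h_n^{-d}$ (mean number of cells per unit volume), regular (the diameter of the zero cell, i.e. the cell containing the origin, has finite moments of all orders) and have the scaling property: the typical cell is equal in distribution to $h_n Z_1$, where $Z_1$ is the typical cell of a stationary random tessellation of intensity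 one that does not depend on $n$. Let the cells of $\pi_n^{(i)}$ be the non-empty sets $V\cap W_n$ with $V$ a cell of $T_n^{(i)}$; or, alternatively, let them be the connected components of these sets (the latter under the proviso that the set $A_n^{(i)}(x)$ depends measurably on the tessellation). Assume that for every $i$, as $n\to\infty$, $\operatorname{diam}(I_n^{(i)}(x))\to0$ in probability and $\mathbb E\big[1/(a_n|A_n^{(i)}(x)|)\big]\to0$. Then for some $c>0$ and all $n$, $$\mathbb E\big[(\hat\lambda^{(RF)}(x)-\lambda(x))^2\big]\le\frac{c}{a_nh_n^d}.$$ 2. (Partition of $z(W_n)$; $\zeta=z$.) If all $\pi_n^{(i)}$ are equal to the partition $\{\{0\},\{1\}\}$ of $z(W_n)$, then for some $c>0$ and all $n$, $$\mathbb E\big[(\hat\lambda^{(RF)}(x)-\lambda(x))^2\big]\le\frac{c}{a_n|W_n|}.$$ -/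

import Mathlib

open MeasureTheory ProbabilityTheory Filter Topology TopologicalSpace
open scoped ENNReal

namespace SpatialForest

/-- The Euclidean space of dimension `d`. -/
abbrev Space (d : ℕ) : Type := EuclideanSpace ℝ (Fin d)

/-! ### Point processes -/

/-- A locally finite configuration of points in the Euclidean space. -/
structure PointConfiguration (d : ℕ) where
  points : Set (Space d)
  locallyFinite : ∀ B : Set (Space d), Bornology.IsBounded B → (points ∩ B).Finite

/-- The σ-algebra generated by the numbers of points in Borel sets. A point process is a
measurable map into `PointConfiguration d`. -/
noncomputable instance PointConfiguration.instMeasurableSpace (d : ℕ) :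
    MeasurableSpace (PointConfiguration d) :=
  ⨆ B : {B : Set (Space d) // MeasurableSet B},
    MeasurableSpace.comap
      (fun ξ : PointConfiguration d => ((ξ.points ∩ B.1).encard : ℝ≥0∞)) inferInstance

/-- `ρ` is the intensity function of the point process `X`: for every Borel set `B`, the mean
number of points in `B` is the integral of `ρ` over `B`. -/
def HasIntensityFunction {d : ℕ} {Ω : Type*} [MeasurableSpace Ω] (P : Measure Ω)
    (X : Ω → PointConfiguration d) (ρ : Space d → ℝ) : Prop :=
  ∀ B : Set (Space d), MeasurableSet B →
    ∫⁻ ω, (((X ω).points ∩ B).encard : ℝ≥0∞) ∂P = ∫⁻ u in B, ENNReal.ofReal (ρ u)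

/-- `ρ₂` is the second order intensity function of the point process `X`. -/
def HasSecondOrderIntensity {d : ℕ} {Ω : Type*} [MeasurableSpace Ω] (P : Measure Ω)
    (X : Ω → PointConfiguration d) (ρ₂ : Space d × Space d → ℝ) : Prop :=
  Measurable ρ₂ ∧ (∀ p, 0 ≤ ρ₂ p) ∧
    ∀ B₁ B₂ : Set (Space d), MeasurableSet B₁ → MeasurableSet B₂ →
      ∫⁻ ω, (({p : Space d × Space d | p.1 ∈ (X ω).points ∧ p.2 ∈ (X ω).points ∧
          p.1 ≠ p.2 ∧ p.1 ∈ B₁ ∧ p.2 ∈ B₂}).encard : ℝ≥0∞) ∂P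
        = ∫⁻ p in B₁ ×ˢ B₂, ENNReal.ofReal (ρ₂ p)

/-- `g` is a pair correlation function of the point process `X` with intensity function `ρ`:
`g (u, v) = ρ₂ (u, v) / (ρ u * ρ v)` wherever `ρ u * ρ v ≠ 0`. The values of `g` elsewhere
(a matter of convention, often `0` or `1`) are left free. -/
def HasPairCorrelation {d : ℕ} {Ω : Type*} [MeasurableSpace Ω] (P : Measure Ω)
    (X : Ω → PointConfiguration d) (ρ : Space d → ℝ) (g : Space d × Space d → ℝ) : Prop :=
  Measurable g ∧ ∃ ρ₂ : Space d × Space d → ℝ, HasSecondOrderIntensity P X ρ₂ ∧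
    ∀ u v, ρ u * ρ v ≠ 0 → g (u, v) = ρ₂ (u, v) / (ρ u * ρ v)

/-! ### Partitions and the purely random forest estimator -/

/-- The cell of the partition `π` that contains `y`. (If several cells contain `y`, which happens
only on boundaries of cells, their union is taken.) -/
def partitionCell {F : Type*} (π : Set (Set F)) (y : F) : Set F :=
  ⋃₀ {I | I ∈ π ∧ y ∈ I}

/-- The set `A(x) = z⁻¹(I(x)) ∩ W`, where `I(x)` is the cell of the partition `π` that
contains `z x`. -/
def spatialCell {d : ℕ} {F : Type*} (z : Space d → F) (W : Set (Space d)) (π : Set (Set F))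
    (x : Space d) : Set (Space d) :=
  z ⁻¹' partitionCell π (z x) ∩ W

/-- The tree intensity estimator at `x`, based on the partition `π`, the covariate `z`, the window
`W` and the normalisation `a`. -/
noncomputable def treeEstimator {d : ℕ} {F : Type*} (a : ℝ) (z : Space d → F)
    (W : Set (Space d)) (π : Set (Set F)) (x : Space d) (ξ : PointConfiguration d) : ℝ :=
  ((ξ.points ∩ spatialCell z W π x).ncard : ℝ) / (a * volume.real (spatialCell z W π x))

/-- The random forest intensity estimator at `x`: the mean of `M` tree estimators. -/
noncomputable def forestEstimator {d M : ℕ} {F : Type*} (a : ℝ) (z : Space d → F)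
    (W : Set (Space d)) (π : Fin M → Set (Set F)) (x : Space d) (ξ : PointConfiguration d) : ℝ :=
  (∑ i, treeEstimator a z W (π i) x ξ) / M

/-! ### Random tessellations -/

/-- A tessellation: a locally finite collection of compact convex polytopes with non-empty
interiors that cover the space and do not overlap. -/
structure Tessellation (d : ℕ) where
  cells : Set (NonemptyCompacts (Space d))
  polytope : ∀ C ∈ cells, ∃ s : Finset (Space d), (C : Set (Space d)) = convexHull ℝ ↑s
  interior_nonempty : ∀ C ∈ cells, (interior (C : Set (Space d))).Nonempty
  locallyFinite : ∀ B : Set (Space d), Bornology.IsBounded B →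
    {C | C ∈ cells ∧ ((C : Set (Space d)) ∩ B).Nonempty}.Finite
  cover : ∀ u : Space d, ∃ C ∈ cells, u ∈ C
  nonoverlapping : ∀ C ∈ cells, ∀ D ∈ cells, C ≠ D →
    Disjoint (interior (C : Set (Space d))) (interior (D : Set (Space d)))

/-- The Borel σ-algebra of the Hausdorff metric on the non-empty compact sets. -/
instance instMeasurableSpaceCompacts (d : ℕ) : MeasurableSpace (NonemptyCompacts (Space d)) :=
  borel _

/-- The σ-algebra generated by the numbers of cells in Borel sets of compact sets. A random
tessellation is a measurable map into `Tessellation d`. -/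
noncomputable instance Tessellation.instMeasurableSpace (d : ℕ) : MeasurableSpace (Tessellation d) :=
  ⨆ B : {B : Set (NonemptyCompacts (Space d)) // MeasurableSet B},
    MeasurableSpace.comap
      (fun T : Tessellation d => ((T.cells ∩ B.1).encard : ℝ≥0∞)) inferInstance

/-- The translate `C + v` of a non-empty compact set. -/
def translateSet {d : ℕ} (v : Space d) (C : NonemptyCompacts (Space d)) :
    NonemptyCompacts (Space d) :=
  C.map (fun u => u + v) (by fun_prop)

/-- The dilate `r C` of a non-empty compact set. -/
def dilateSet {d : ℕ} (r : ℝ) (C : NonemptyCompacts (Space d)) : NonemptyCompacts (Space d) :=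
  C.map (fun u => r • u) (by fun_prop)

theorem coe_translateSet {d : ℕ} (v : Space d) (C : NonemptyCompacts (Space d)) :
    (translateSet v C : Set (Space d)) = Homeomorph.addRight v '' (C : Set (Space d)) := rfl

/-- The translate of a tessellation by the vector `v`. -/
def Tessellation.translate {d : ℕ} (v : Space d) (T : Tessellation d) : Tessellation d where
  cells := translateSet v '' T.cells
  polytope := by
    classical
    rintro _ ⟨C, hC, rfl⟩
    obtain ⟨s, hs⟩ := T.polytope C hC
    refine ⟨s.image (fun u => u + v), ?_⟩
    have h := (AffineEquiv.constVAdd ℝ (Space d) v).toAffineMap.image_convexHull (s : Set (Space d))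
    rw [coe_translateSet, hs]
    have e : (⇑(AffineEquiv.constVAdd ℝ (Space d) v).toAffineMap : Space d → Space d)
        = fun u => u + v := by
      funext u
      simp [add_comm]
    rw [e] at h
    simpa using! h
  interior_nonempty := by
    rintro _ ⟨C, hC, rfl⟩
    rw [coe_translateSet, ← Homeomorph.image_interior]
    exact (T.interior_nonempty C hC).image _
  locallyFinite := by
    intro B hB
    have hB' : Bornology.IsBounded ((fun u => u + v) ⁻¹' B) := by
      have : ((fun u : Space d => u + v) ⁻¹' B) = (fun u => u + (-v)) '' B := by
        simp
      rw [this]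
      exact (LipschitzWith.id.add (LipschitzWith.const (-v))).isBounded_image hB
    refine ((T.locallyFinite _ hB').image (translateSet v)).subset ?_
    rintro _ ⟨⟨C, hC, rfl⟩, w, hw, hwB⟩
    rw [coe_translateSet] at hw
    obtain ⟨u, hu, rfl⟩ := hw
    exact ⟨C, ⟨hC, u, hu, hwB⟩, rfl⟩
  cover := by
    intro u
    obtain ⟨C, hC, hu⟩ := T.cover (u - v)
    refine ⟨translateSet v C, ⟨C, hC, rfl⟩, ?_⟩
    have : u ∈ (translateSet v C : Set (Space d)) := ⟨u - v, hu, by simp⟩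
    exact this
  nonoverlapping := by
    rintro _ ⟨C, hC, rfl⟩ _ ⟨D, hD, rfl⟩ hne
    rw [coe_translateSet, coe_translateSet, ← Homeomorph.image_interior,
      ← Homeomorph.image_interior]
    refine (Set.disjoint_image_iff (Homeomorph.addRight v).injective).2
      (T.nonoverlapping C hC D hD ?_)
    rintro rfl
    exact hne rfl

/-- A random tessellation is stationary if its law is invariant under all translations. -/
def IsStationaryTessellation {d : ℕ} {Ω : Type*} [MeasurableSpace Ω] (P : Measure Ω)
    (T : Ω → Tessellation d) : Prop :=
  ∀ v : Space d, IdentDistrib T (fun ω => (T ω).translate v) P P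

/-- The centroid of a compact set, used as the reference point of a cell. -/
noncomputable def centroid {d : ℕ} (C : NonemptyCompacts (Space d)) : Space d :=
  ⨍ u in (C : Set (Space d)), u

/-- The half-open unit cube. -/
def unitCube (d : ℕ) : Set (Space d) := {u | ∀ i, 0 ≤ u i ∧ u i < 1}

/-- The mean number of cells of the random tessellation `T` that lie in the set `S` of compact
sets. -/
noncomputable def meanCellCount {d : ℕ} {Ω : Type*} [MeasurableSpace Ω] (P : Measure Ω)
    (T : Ω → Tessellation d) (S : Set (NonemptyCompacts (Space d))) : ℝ≥0∞ :=
  ∫⁻ ω, (((T ω).cells ∩ S).encard : ℝ≥0∞) ∂P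

/-- The intensity of a stationary tessellation: the mean number of cells per unit volume. -/
noncomputable def tessellationIntensity {d : ℕ} {Ω : Type*} [MeasurableSpace Ω] (P : Measure Ω)
    (T : Ω → Tessellation d) : ℝ≥0∞ :=
  meanCellCount P T {C | centroid C ∈ unitCube d}

/-- The law of the typical cell of a stationary tessellation, as a function of Borel sets `B` of
compact sets: the mean number of cells with centroid in the unit cube whose centred version lies
in `B`, divided by the mean number of all cells with centroid in the unit cube. -/
noncomputable def typicalCellLaw {d : ℕ} {Ω : Type*} [MeasurableSpace Ω] (P : Measure Ω)
    (T : Ω → Tessellation d) (B : Set (NonemptyCompacts (Space d))) : ℝ≥0∞ :=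
  meanCellCount P T {C | centroid C ∈ unitCube d ∧ translateSet (-centroid C) C ∈ B}
    / tessellationIntensity P T

/-- The scaling property, for a tessellation `T` of intensity `γ` and the tessellation `T₁` of
intensity one in the same model: the typical cells satisfy `Z_γ = γ^(-1/d) Z_1` in law. -/
def HasScalingProperty {d : ℕ} {Ω Ω₁ : Type*} [MeasurableSpace Ω] [MeasurableSpace Ω₁]
    (P : Measure Ω) (T : Ω → Tessellation d) (γ : ℝ)
    (P₁ : Measure Ω₁) (T₁ : Ω₁ → Tessellation d) : Prop :=
  ∀ B : Set (NonemptyCompacts (Space d)), MeasurableSet B →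
    typicalCellLaw P T B
      = typicalCellLaw P₁ T₁ {C | dilateSet (γ ^ (-1 / (d : ℝ))) C ∈ B}

/-- The zero cell of a tessellation. -/
def zeroCell {d : ℕ} (T : Tessellation d) : Set (Space d) :=
  partitionCell ((fun C : NonemptyCompacts (Space d) => (C : Set (Space d))) '' T.cells) 0

/-- A stationary tessellation is regular if the diameter of its zero cell has finite moments of
all orders. -/
def IsRegularTessellation {d : ℕ} {Ω : Type*} [MeasurableSpace Ω] (P : Measure Ω)
    (T : Ω → Tessellation d) : Prop :=
  ∀ k : ℕ, ∫⁻ ω, ENNReal.ofReal (Metric.diam (zeroCell (T ω)) ^ k) ∂P < ∞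

/-- The partition of the window `W` into the non-empty sets `V ∩ W`, for `V` a cell of `T`. -/
def windowCells {d : ℕ} (T : Tessellation d) (W : Set (Space d)) : Set (Set (Space d)) :=
  {I | ∃ V ∈ T.cells, I = (V : Set (Space d)) ∩ W ∧ I.Nonempty}

/-- The partition of the window `W` into the connected components of the sets `V ∩ W`, for `V` a
cell of `T`. -/
def windowSubcells {d : ℕ} (T : Tessellation d) (W : Set (Space d)) : Set (Set (Space d)) :=
  {I | ∃ V ∈ T.cells, ∃ u ∈ (V : Set (Space d)) ∩ W,
    I = connectedComponentIn ((V : Set (Space d)) ∩ W) u}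

end SpatialForest

open SpatialForest

/-! Bias and variance are separated on a fixed cell `A`, and the cell is then averaged over the
tessellation. For fixed `A` the count `N` satisfies `N² = N(N - 1) + N`. The factorial part is
controlled by the pair correlation hypothesis, which leaves a mean square error of at most `C /
(a|A|)` plus the squared bias (`mse_bound`). Since `z` takes two values near `x` and is continuous
there, `λ` is constant on a ball around `x`. A cell inside this ball has no bias, and any other cell
has bias at most `K = sup f`. For the level set of `z` the bias vanishes altogether, and the lower
bound on its volume gives the second claim.

For a random cell independent of the points, the error is thus at most `C · E[1/(a|A|)] + K² · P(A ⊄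
ball)` (`tree_mse_le`). It remains to bound both terms by a multiple of `1/(a hᵈ)`.

The scaling hypothesis concerns typical cells, whereas `A` comes from the cell that contains `x`.
The inversion formula of Palm theory (`setLIntegral_zero_mem`) writes means over cells containing
the origin as volume-weighted means over typical cells. Hence the zero cell at scale `h` behaves
like `h` times the zero cell of the model of intensity one (`setLIntegral_zero_mem_scaling`). A
given point almost surely lies in exactly one cell (`ae_existsUnique_cell`).

The first term scales like `h⁻ᵈ` times a mean inverse volume of the model of intensity one,
truncated to a ball. This is finite at one radius because `E[1/(a|A|)] → 0`, and at all positive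
radii because cells are convex (`exists_inverse_content_bound`). For the second term, Markov's
inequality for the `k`-th moment gives a multiple of `hᵏ`. If `k > 1/ε` and `a ≥ 1`, then `h <
a^(-ε)` yields `hᵏ ≤ 1/(a hᵈ)` (`exists_escape_bound`). That `a ≥ 1` eventually follows from the two
limit hypotheses (`eventually_one_le`). -/

namespace SpatialForest

variable {d : ℕ}

/-! ### Translation, dilation and measurability on the space of compact sets -/

instance : BorelSpace (NonemptyCompacts (Space d)) := ⟨rfl⟩

theorem mem_translateSet {v u : Space d} {C : NonemptyCompacts (Space d)} :
    u ∈ translateSet v C ↔ u - v ∈ C := by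
  change u ∈ (fun u => u + v) '' (C : Set (Space d)) ↔ _
  constructor
  · rintro ⟨w, hw, rfl⟩
    simpa using hw
  · intro h
    exact ⟨u - v, h, by simp⟩

theorem translateSet_zero (C : NonemptyCompacts (Space d)) : translateSet 0 C = C := by
  ext u
  change u ∈ translateSet 0 C ↔ _
  rw [mem_translateSet]; simp

theorem translateSet_translateSet (v w : Space d) (C : NonemptyCompacts (Space d)) :
    translateSet v (translateSet w C) = translateSet (w + v) C := by
  ext u
  change u ∈ translateSet v (translateSet w C) ↔ u ∈ translateSet (w + v) C
  simp only [mem_translateSet]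
  rw [show u - v - w = u - (w + v) by abel]

theorem translateSet_injective (v : Space d) :
    Function.Injective (translateSet v : NonemptyCompacts (Space d) → _) := by
  intro C D h
  have := congrArg (translateSet (-v)) h
  simpa [translateSet_translateSet, translateSet_zero] using this

theorem coe_translateSet' (v : Space d) (C : NonemptyCompacts (Space d)) :
    (translateSet v C : Set (Space d)) = (fun u => u - v) ⁻¹' (C : Set (Space d)) := by
  ext u
  exact mem_translateSet

theorem mem_dilateSet {r : ℝ} (hr : r ≠ 0) {u : Space d} {C : NonemptyCompacts (Space d)} :
    u ∈ dilateSet r C ↔ r⁻¹ • u ∈ C := by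
  change u ∈ (fun u => r • u) '' (C : Set (Space d)) ↔ _
  constructor
  · rintro ⟨w, hw, rfl⟩
    simpa [smul_smul, inv_mul_cancel₀ hr] using hw
  · intro h
    exact ⟨r⁻¹ • u, h, by simp [smul_smul, mul_inv_cancel₀ hr]⟩

theorem dilateSet_translateSet (r : ℝ) (v : Space d) (C : NonemptyCompacts (Space d)) :
    dilateSet r (translateSet v C) = translateSet (r • v) (dilateSet r C) := by
  apply SetLike.coe_injective
  change (fun u => r • u) '' ((fun u => u + v) '' (C : Set (Space d)))
    = (fun u => u + r • v) '' ((fun u => r • u) '' (C : Set (Space d)))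
  simp only [Set.image_image, smul_add]

theorem continuous_translateSet :
    Continuous fun p : Space d × NonemptyCompacts (Space d) => translateSet p.1 p.2 :=
  Continuous.nonemptyCompacts_map' (f := fun p : Space d × NonemptyCompacts (Space d) => p.2)
    (g := fun p u => u + p.1) continuous_snd
    (by unfold Function.uncurry; fun_prop)

theorem measurable_translateSet :
    Measurable fun p : Space d × NonemptyCompacts (Space d) => translateSet p.1 p.2 :=
  continuous_translateSet.measurable

theorem measurable_translateSet_const (v : Space d) :
    Measurable (translateSet v : NonemptyCompacts (Space d) → _) :=
  measurable_translateSet.comp measurable_prodMk_left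

theorem measurable_dilateSet (r : ℝ) :
    Measurable (dilateSet r : NonemptyCompacts (Space d) → _) :=
  (Continuous.nonemptyCompacts_map (by fun_prop)).measurable

theorem continuous_infDist_coe : Continuous fun p : NonemptyCompacts (Space d) × Space d =>
    Metric.infDist p.2 (p.1 : Set (Space d)) := by
  have h : Continuous fun q : Space d × NonemptyCompacts (Space d) =>
      Metric.infDist q.1 (q.2 : Set (Space d)) := Metric.lipschitz_infDist.continuous
  have h' : Continuous fun p : NonemptyCompacts (Space d) × Space d => (p.2, p.1) :=
    continuous_snd.prodMk continuous_fst
  have := h.comp h'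
  exact this

/-- The distance from a point to a compact set is jointly continuous, and incidence is its zero set.
Measurability of volumes, centroids and position integrals all rests on this. -/
theorem isClosed_mem :
    IsClosed {p : NonemptyCompacts (Space d) × Space d | p.2 ∈ p.1} := by
  have h : {p : NonemptyCompacts (Space d) × Space d | p.2 ∈ p.1}
      = {p | Metric.infDist p.2 (p.1 : Set (Space d)) = 0} := by
    ext p
    exact p.1.isCompact.isClosed.mem_iff_infDist_zero p.1.nonempty
  rw [h]
  exact isClosed_eq continuous_infDist_coe continuous_const

theorem measurableSet_mem :
    MeasurableSet {p : NonemptyCompacts (Space d) × Space d | p.2 ∈ p.1} :=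
  isClosed_mem.measurableSet

theorem measurableSet_mem_left (u : Space d) :
    MeasurableSet {C : NonemptyCompacts (Space d) | u ∈ C} :=
  measurable_prodMk_right (y := u) measurableSet_mem

theorem measurable_volume_inter {B : Set (Space d)} (hB : MeasurableSet B) :
    Measurable fun C : NonemptyCompacts (Space d) => volume ((C : Set (Space d)) ∩ B) := by
  have h : MeasurableSet
      ({p : NonemptyCompacts (Space d) × Space d | p.2 ∈ p.1} ∩ {p | p.2 ∈ B}) :=
    measurableSet_mem.inter (measurable_snd hB)
  exact measurable_measure_prodMk_left h

theorem measurable_volume_coe :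
    Measurable fun C : NonemptyCompacts (Space d) => volume (C : Set (Space d)) := by
  simpa using measurable_volume_inter (d := d) MeasurableSet.univ

theorem measurable_centroid : Measurable (centroid : NonemptyCompacts (Space d) → Space d) := by
  have h1 : Measurable fun C : NonemptyCompacts (Space d) => ∫ u in (C : Set (Space d)), u := by
    have h2 : StronglyMeasurable fun p : NonemptyCompacts (Space d) × Space d =>
        {p : NonemptyCompacts (Space d) × Space d | p.2 ∈ p.1}.indicator (fun p => p.2) p :=
      (measurable_snd.indicator measurableSet_mem).stronglyMeasurable
    have h3 := (h2.integral_prod_right' (ν := volume)).measurable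
    convert! h3 using 2 with C
    rw [← integral_indicator C.isCompact.measurableSet]
    rfl
  have h4 : (centroid : NonemptyCompacts (Space d) → Space d) = fun C : NonemptyCompacts (Space d) =>
      (volume (C : Set (Space d))).toReal⁻¹ • ∫ u in (C : Set (Space d)), u := by
    funext C
    rw [centroid, setAverage_eq]; rfl
  rw [h4]
  exact (measurable_volume_coe.ennreal_toReal.inv).smul h1

theorem volume_translateSet (v : Space d) (C : NonemptyCompacts (Space d)) :
    volume (translateSet v C : Set (Space d)) = volume (C : Set (Space d)) := by
  rw [coe_translateSet']
  exact (measurePreserving_sub_right volume v).measure_preimage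
    C.isCompact.measurableSet.nullMeasurableSet

/-- Positive volume is essential: a null set has centroid `0` by the convention for averages,
wherever it lies. -/
theorem centroid_translateSet (v : Space d) {C : NonemptyCompacts (Space d)}
    (hC : volume (C : Set (Space d)) ≠ 0) :
    centroid (translateSet v C) = centroid C + v := by
  have hfin : volume (C : Set (Space d)) ≠ ∞ := C.isCompact.measure_lt_top.ne
  have e : (∫ u in (translateSet v C : Set (Space d)), u)
      = ∫ u in (C : Set (Space d)), (u + v) := by
    rw [coe_translateSet']
    have := (measurePreserving_sub_right volume v).setIntegral_preimage_emb
      (MeasurableEquiv.subRight v).measurableEmbedding (fun u : Space d => u + v)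
      (C : Set (Space d))
    simpa using this
  have hi : IntegrableOn (fun u : Space d => u) (C : Set (Space d)) :=
    continuous_id.continuousOn.integrableOn_compact C.isCompact
  have hr : volume.real (C : Set (Space d)) ≠ 0 := (ENNReal.toReal_ne_zero).2 ⟨hC, hfin⟩
  rw [centroid, centroid, setAverage_eq, setAverage_eq, e, measureReal_def, volume_translateSet,
    ← measureReal_def, integral_add hi (integrableOn_const hfin), setIntegral_const, smul_add,
    smul_smul, inv_mul_cancel₀ hr, one_smul]

/-! ### Geometry of tessellations and the counting measure on cells -/

theorem Tessellation.convex_of_mem (t : Tessellation d) {C : NonemptyCompacts (Space d)}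
    (hC : C ∈ t.cells) : Convex ℝ (C : Set (Space d)) := by
  obtain ⟨s, hs⟩ := t.polytope C hC
  rw [hs]
  exact convex_convexHull ℝ _

theorem Tessellation.volume_ne_zero (t : Tessellation d) {C : NonemptyCompacts (Space d)}
    (hC : C ∈ t.cells) : volume (C : Set (Space d)) ≠ 0 :=
  (Measure.measure_pos_of_nonempty_interior _ (t.interior_nonempty C hC)).ne'

theorem Tessellation.countable_cells (t : Tessellation d) : t.cells.Countable := by
  have h : t.cells ⊆ ⋃ k : ℕ, {C | C ∈ t.cells ∧
      ((C : Set (Space d)) ∩ Metric.ball 0 (k : ℝ)).Nonempty} := by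
    intro C hC
    obtain ⟨u, hu⟩ := C.nonempty
    obtain ⟨k, hk⟩ := exists_nat_gt (dist u 0)
    exact Set.mem_iUnion.2 ⟨k, hC, u, hu, hk⟩
  exact (Set.countable_iUnion fun k =>
    (t.locallyFinite _ Metric.isBounded_ball).countable).mono h

theorem Tessellation.measurableSet_cells (t : Tessellation d) : MeasurableSet t.cells :=
  t.countable_cells.measurableSet

/-- A convex body is the closure of its interior, so disjointness of the interiors makes `D` miss
the whole interior of `C`. The overlap then lies in the frontier of a convex set, which is null. -/
theorem Tessellation.volume_inter_eq_zero (t : Tessellation d)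
    {C D : NonemptyCompacts (Space d)} (hC : C ∈ t.cells) (hD : D ∈ t.cells) (hne : C ≠ D) :
    volume ((C : Set (Space d)) ∩ D) = 0 := by
  have h1 : Disjoint (interior (C : Set (Space d))) (D : Set (Space d)) := by
    have h2 := (t.nonoverlapping C hC D hD hne).closure_right isOpen_interior
    rwa [(t.convex_of_mem hD).closure_interior_eq_closure_of_nonempty_interior
      (t.interior_nonempty D hD), D.isCompact.isClosed.closure_eq] at h2
  refine measure_mono_null ?_ ((t.convex_of_mem hC).addHaar_frontier volume)
  rintro u ⟨huC, huD⟩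
  exact ⟨subset_closure huC, fun hu => Set.disjoint_left.1 h1 hu huD⟩

/-- The counting measure on the cells of a tessellation. -/
noncomputable def cellMeasure (t : Tessellation d) : Measure (NonemptyCompacts (Space d)) :=
  Measure.count.restrict t.cells

theorem cellMeasure_apply (t : Tessellation d) {S : Set (NonemptyCompacts (Space d))}
    (hS : MeasurableSet S) : cellMeasure t S = ((t.cells ∩ S).encard : ℝ≥0∞) := by
  rw [cellMeasure, Measure.restrict_apply hS,
    Measure.count_apply (hS.inter t.measurableSet_cells), Set.inter_comm]

theorem ae_cellMeasure {t : Tessellation d} {p : NonemptyCompacts (Space d) → Prop}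
    (h : ∀ C ∈ t.cells, p C) : ∀ᵐ C ∂cellMeasure t, p C :=
  ae_restrict_of_forall_mem t.measurableSet_cells h

theorem le_lintegral_cellMeasure {t : Tessellation d} {C : NonemptyCompacts (Space d)}
    (hC : C ∈ t.cells) (φ : NonemptyCompacts (Space d) → ℝ≥0∞) :
    φ C ≤ ∫⁻ D, φ D ∂cellMeasure t := by
  calc φ C = ∫⁻ D in {C}, φ D ∂Measure.count := by
        rw [lintegral_singleton, Measure.count_singleton, mul_one]
    _ ≤ _ := lintegral_mono_set (Set.singleton_subset_iff.2 hC)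

instance (t : Tessellation d) : SigmaFinite (cellMeasure t) := by
  have := t.countable_cells
  have h : (insert t.cellsᶜ ((fun C => ({C} : Set (NonemptyCompacts (Space d)))) '' t.cells)).Countable :=
    (this.image _).insert _
  refine Measure.sigmaFinite_of_countable h ?_ ?_
  · rintro s (rfl | ⟨C, -, rfl⟩)
    · rw [cellMeasure_apply _ t.measurableSet_cells.compl]
      simp
    · rw [cellMeasure_apply _ (measurableSet_singleton C)]
      have : (t.cells ∩ {C}).encard ≤ 1 :=
        (Set.encard_le_encard Set.inter_subset_right).trans (by simp)
      exact lt_of_le_of_lt (ENat.toENNReal_le.2 this) (by simp)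
  · ext C
    simp only [Set.mem_sUnion, Set.mem_univ, iff_true]
    by_cases hC : C ∈ t.cells
    · exact ⟨{C}, Or.inr ⟨C, hC, rfl⟩, rfl⟩
    · exact ⟨_, Or.inl rfl, hC⟩

theorem measurable_cellMeasure :
    Measurable (cellMeasure : Tessellation d → Measure (NonemptyCompacts (Space d))) := by
  refine Measure.measurable_of_measurable_coe _ fun S hS => ?_
  simp_rw [cellMeasure_apply _ hS]
  refine Measurable.mono (ma := MeasurableSpace.comap
    (fun T : Tessellation d => ((T.cells ∩ S).encard : ℝ≥0∞)) inferInstance)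
    (comap_measurable _) ?_ le_rfl
  exact le_iSup (fun B : {B : Set (NonemptyCompacts (Space d)) // MeasurableSet B} =>
    MeasurableSpace.comap
      (fun T : Tessellation d => ((T.cells ∩ B.1).encard : ℝ≥0∞)) inferInstance) ⟨S, hS⟩

/-! ### The intensity measure of the cells and the inversion formula -/

section Intensity

variable {Ω : Type*} [MeasurableSpace Ω] {P : Measure Ω} {T : Ω → Tessellation d}

/-- The intensity measure of a random tessellation, on the space of compact sets. -/
noncomputable def cellIntensity (P : Measure Ω) (T : Ω → Tessellation d) :
    Measure (NonemptyCompacts (Space d)) :=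
  P.bind fun ω => cellMeasure (T ω)

theorem cellIntensity_apply (hT : Measurable T) {S : Set (NonemptyCompacts (Space d))}
    (hS : MeasurableSet S) : cellIntensity P T S = meanCellCount P T S := by
  have hm : Measurable fun ω => cellMeasure (T ω) := measurable_cellMeasure.comp hT
  rw [cellIntensity, Measure.bind_apply hS hm.aemeasurable]
  simp_rw [cellMeasure_apply _ hS]
  rfl

theorem lintegral_cellIntensity (hT : Measurable T) {φ : NonemptyCompacts (Space d) → ℝ≥0∞}
    (hφ : Measurable φ) :
    ∫⁻ C, φ C ∂cellIntensity P T = ∫⁻ ω, ∫⁻ C, φ C ∂cellMeasure (T ω) ∂P :=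
  Measure.lintegral_bind (measurable_cellMeasure.comp hT).aemeasurable hφ.aemeasurable

theorem setLIntegral_cellIntensity (hT : Measurable T) {S : Set (NonemptyCompacts (Space d))}
    (hS : MeasurableSet S) {φ : NonemptyCompacts (Space d) → ℝ≥0∞} (hφ : Measurable φ) :
    ∫⁻ C in S, φ C ∂cellIntensity P T = ∫⁻ ω, ∫⁻ C in S, φ C ∂cellMeasure (T ω) ∂P := by
  rw [← lintegral_indicator hS, lintegral_cellIntensity hT (hφ.indicator hS)]
  simp_rw [lintegral_indicator hS]

theorem ae_cellIntensity_volume_ne_zero (hT : Measurable T) :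
    ∀ᵐ C : NonemptyCompacts (Space d) ∂cellIntensity P T, volume (C : Set (Space d)) ≠ 0 := by
  have hm : MeasurableSet {C : NonemptyCompacts (Space d) | volume (C : Set (Space d)) = 0} :=
    measurable_volume_coe (measurableSet_singleton 0)
  rw [ae_iff]
  simp only [ne_eq, not_not]
  have hm' : Measurable fun ω => cellMeasure (T ω) := measurable_cellMeasure.comp hT
  rw [cellIntensity, Measure.bind_apply hm hm'.aemeasurable]
  refine (lintegral_congr fun ω => ?_).trans lintegral_zero
  have := ae_cellMeasure (t := T ω)
    (p := fun C => volume (C : Set (Space d)) ≠ 0) fun C hC => (T ω).volume_ne_zero hC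
  rw [ae_iff] at this
  simpa using this

theorem cellIntensity_map_translateSet (hT : Measurable T) (hst : IsStationaryTessellation P T)
    (v : Space d) : (cellIntensity P T).map (translateSet v) = cellIntensity P T := by
  ext S hS
  have hS' := measurable_translateSet_const v hS
  rw [Measure.map_apply (measurable_translateSet_const v) hS, cellIntensity_apply hT hS',
    cellIntensity_apply hT hS, meanCellCount, meanCellCount]
  have hm : Measurable fun t : Tessellation d => ((t.cells ∩ S).encard : ℝ≥0∞) := by
    have := (Measure.measurable_coe hS).comp (measurable_cellMeasure (d := d))
    simpa only [Function.comp_def, cellMeasure_apply _ hS] using this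
  have h := ((hst v).comp hm).lintegral_eq
  simp only [Function.comp_def] at h
  rw [h]
  refine lintegral_congr fun ω => ?_
  congr 1
  rw [← (translateSet_injective v).encard_image]
  congr 1
  ext C
  simp only [Set.mem_image, Set.mem_inter_iff, Set.mem_preimage, Tessellation.translate]
  constructor
  · rintro ⟨D, ⟨h1, h2⟩, rfl⟩
    exact ⟨⟨D, h1, rfl⟩, h2⟩
  · rintro ⟨⟨D, h1, rfl⟩, h2⟩
    exact ⟨D, ⟨h1, h2⟩, rfl⟩

theorem lintegral_translateSet (hT : Measurable T) (hst : IsStationaryTessellation P T)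
    (v : Space d) {φ : NonemptyCompacts (Space d) → ℝ≥0∞} (hφ : Measurable φ) :
    ∫⁻ C : NonemptyCompacts (Space d), φ (translateSet v C) ∂cellIntensity P T = ∫⁻ C, φ C ∂cellIntensity P T := by
  conv_rhs => rw [← cellIntensity_map_translateSet hT hst v]
  rw [lintegral_map hφ (measurable_translateSet_const v)]

theorem measurableSet_unitCube : MeasurableSet (unitCube d) := by
  have : unitCube d = ⋂ i, (fun u : Space d => u i) ⁻¹' Set.Ico 0 1 := by
    ext u; simp [unitCube]
  rw [this]
  exact MeasurableSet.iInter fun i => measurableSet_Ico.preimage (by fun_prop)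

theorem volume_unitCube : volume (unitCube d) = 1 := by
  have h : unitCube d = (WithLp.ofLp : Space d → Fin d → ℝ) ⁻¹'
      Set.univ.pi fun _ => Set.Ico 0 1 := by
    ext u; simp [unitCube]
  rw [h, (PiLp.volume_preserving_ofLp (Fin d)).measure_preimage
    (MeasurableSet.univ_pi fun _ => measurableSet_Ico).nullMeasurableSet, Real.volume_pi_Ico]
  simp

theorem cellIntensity_centroid_preimage (hT : Measurable T) :
    cellIntensity P T (centroid ⁻¹' unitCube d) = tessellationIntensity P T :=
  cellIntensity_apply hT (measurable_centroid measurableSet_unitCube)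

/-- The space is cut according to the integer translate of the unit cube that contains the centroid.
By stationarity every piece has the same mass, the intensity. This licenses the applications of
Tonelli's theorem below. -/
theorem sigmaFinite_cellIntensity (hT : Measurable T) (hst : IsStationaryTessellation P T)
    (hfin : tessellationIntensity P T ≠ ∞) : SigmaFinite (cellIntensity P T) := by
  let S : (Fin d → ℤ) → Set (NonemptyCompacts (Space d)) := fun k =>
    {C | centroid C + WithLp.toLp 2 (fun i => (k i : ℝ)) ∈ unitCube d}
  have hS : ∀ k, cellIntensity P T (S k) < ∞ := by
    intro k
    have h1 : cellIntensity P T (S k) = cellIntensity P T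
        (translateSet (WithLp.toLp 2 (fun i => (k i : ℝ))) ⁻¹' (centroid ⁻¹' unitCube d)) := by
      apply measure_congr
      filter_upwards [ae_cellIntensity_volume_ne_zero (P := P) hT] with C hC
      simp only [S, eq_iff_iff]
      change _ ∈ unitCube d ↔ centroid (translateSet _ C) ∈ unitCube d
      rw [centroid_translateSet _ hC]
    rw [h1, ← Measure.map_apply (measurable_translateSet_const _)
      (measurable_centroid measurableSet_unitCube), cellIntensity_map_translateSet hT hst,
      cellIntensity_centroid_preimage hT]
    exact hfin.lt_top
  refine Measure.sigmaFinite_of_countable (Set.countable_range S) ?_ ?_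
  · rintro _ ⟨k, rfl⟩
    exact hS k
  · refine Set.eq_univ_of_forall fun C => ?_
    refine ⟨_, ⟨fun i => -⌊centroid C i⌋, rfl⟩, fun i => ?_⟩
    have h1 := Int.floor_le (centroid C i)
    have h2 := Int.lt_floor_add_one (centroid C i)
    simp only [PiLp.add_apply, Int.cast_neg]
    constructor <;> linarith

/-- The integral of `φ` over all positions of the origin within the set `C`. -/
noncomputable def positionIntegral (φ : NonemptyCompacts (Space d) → ℝ≥0∞)
    (C : NonemptyCompacts (Space d)) : ℝ≥0∞ :=
  ∫⁻ u in (C : Set (Space d)), φ (translateSet (-u) C)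

theorem measurable_translateSet_neg :
    Measurable fun p : NonemptyCompacts (Space d) × Space d => translateSet (-p.2) p.1 :=
  measurable_translateSet.comp (measurable_snd.neg.prodMk measurable_fst)

theorem positionIntegral_eq (φ : NonemptyCompacts (Space d) → ℝ≥0∞)
    (C : NonemptyCompacts (Space d)) : positionIntegral φ C
      = ∫⁻ u, {D : NonemptyCompacts (Space d) | 0 ∈ D}.indicator φ (translateSet (-u) C) := by
  rw [positionIntegral, ← lintegral_indicator C.isCompact.measurableSet]
  refine lintegral_congr fun u => ?_
  have : translateSet (-u) C ∈ {D : NonemptyCompacts (Space d) | 0 ∈ D} ↔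
      u ∈ (C : Set (Space d)) := by
    change (0 : Space d) ∈ translateSet (-u) C ↔ u ∈ C
    rw [mem_translateSet]; simp
  by_cases hu : u ∈ (C : Set (Space d))
  · rw [Set.indicator_of_mem hu, Set.indicator_of_mem (this.2 hu)]
  · rw [Set.indicator_of_notMem hu, Set.indicator_of_notMem (fun h => hu (this.1 h))]

theorem measurable_positionIntegral {φ : NonemptyCompacts (Space d) → ℝ≥0∞}
    (hφ : Measurable φ) : Measurable (positionIntegral φ) := by
  have : positionIntegral φ = _ := funext fun C => positionIntegral_eq φ C
  rw [this]
  exact Measurable.lintegral_prod_right'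
    (f := fun p : NonemptyCompacts (Space d) × Space d =>
      {D : NonemptyCompacts (Space d) | 0 ∈ D}.indicator φ (translateSet (-p.2) p.1))
    ((hφ.indicator (measurableSet_mem_left 0)).comp measurable_translateSet_neg)

/-- The position integral depends on the shape alone, so it can be evaluated at the centred cell,
whose law is that of the typical cell. -/
theorem positionIntegral_translateSet (φ : NonemptyCompacts (Space d) → ℝ≥0∞) (v : Space d)
    (C : NonemptyCompacts (Space d)) :
    positionIntegral φ (translateSet v C) = positionIntegral φ C := by
  rw [positionIntegral_eq, positionIntegral_eq]
  simp only [translateSet_translateSet]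
  have := lintegral_sub_right_eq_self (μ := volume) (fun u : Space d =>
    {D : NonemptyCompacts (Space d) | 0 ∈ D}.indicator φ (translateSet (-u) C)) v
  rw [← this]
  refine lintegral_congr fun u => ?_
  rw [show -(u - v) = v + -u by abel]

/-- Palm inversion: averaging over the cells around a fixed origin amounts to averaging over the
cells with centroid in a unit cube and over all positions of the origin inside them. The proof is a
mass transport argument with Tonelli's theorem and stationarity. -/
theorem setLIntegral_zero_mem (hT : Measurable T) (hst : IsStationaryTessellation P T)
    (hfin : tessellationIntensity P T ≠ ∞) {φ : NonemptyCompacts (Space d) → ℝ≥0∞}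
    (hφ : Measurable φ) :
    ∫⁻ C in {C | 0 ∈ C}, φ C ∂cellIntensity P T
      = ∫⁻ C in centroid ⁻¹' unitCube d, positionIntegral φ C ∂cellIntensity P T := by
  have := sigmaFinite_cellIntensity hT hst hfin
  set Λ := cellIntensity P T
  set F := {C : NonemptyCompacts (Space d) | 0 ∈ C}.indicator φ with hF
  have hFm : Measurable F := hφ.indicator (measurableSet_mem_left 0)
  set q : Space d → ℝ≥0∞ := (unitCube d).indicator 1 with hq
  have hqm : Measurable q := measurable_one.indicator measurableSet_unitCube
  have hqi : ∫⁻ u, q u = 1 := by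
    rw [hq, lintegral_indicator_one measurableSet_unitCube, volume_unitCube]
  calc ∫⁻ C in {C | 0 ∈ C}, φ C ∂Λ
      = ∫⁻ C, F C ∂Λ := (lintegral_indicator (measurableSet_mem_left 0) φ).symm
    -- The factor inserted is `∫ q = 1`, with `q` evaluated at the centroid of a shifted cell;
    -- almost every cell has positive volume, so its centroid shifts along.
    _ = ∫⁻ C, (∫⁻ u, F C * q (centroid (translateSet u C))) ∂Λ := by
        refine lintegral_congr_ae ?_
        filter_upwards [ae_cellIntensity_volume_ne_zero (P := P) hT] with C hC
        simp_rw [centroid_translateSet _ hC]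
        have hm : Measurable fun u => q (centroid C + u) := hqm.comp (measurable_const_add _)
        rw [lintegral_const_mul _ hm, lintegral_add_left_eq_self (μ := volume) q (centroid C), hqi, mul_one]
    _ = ∫⁻ u, ∫⁻ C, F C * q (centroid (translateSet u C)) ∂Λ := by
        refine lintegral_lintegral_swap (Measurable.aemeasurable ?_)
        exact (hFm.comp measurable_fst).mul (hqm.comp (measurable_centroid.comp
          (measurable_translateSet.comp (measurable_snd.prodMk measurable_fst))))
    -- Stationarity moves the shift from the centroid to `F`.
    _ = ∫⁻ u, ∫⁻ C, F (translateSet (-u) C) * q (centroid C) ∂Λ := by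
        refine lintegral_congr fun u => ?_
        rw [← lintegral_translateSet hT hst (-u)]
        · simp_rw [translateSet_translateSet, neg_add_cancel, translateSet_zero]
          rfl
        · exact hFm.mul (hqm.comp (measurable_centroid.comp (measurable_translateSet_const u)))
    _ = ∫⁻ C, (∫⁻ u, F (translateSet (-u) C) * q (centroid C)) ∂Λ := by
        refine lintegral_lintegral_swap (Measurable.aemeasurable ?_)
        exact (hFm.comp (measurable_translateSet_neg.comp measurable_swap)).mul
          (hqm.comp (measurable_centroid.comp measurable_snd))
    _ = ∫⁻ C, (centroid ⁻¹' unitCube d).indicator (positionIntegral φ) C ∂Λ := by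
        refine lintegral_congr fun C => ?_
        have hm : Measurable fun u : Space d => F (translateSet (-u) C) :=
          hFm.comp (measurable_translateSet_neg.comp measurable_prodMk_left)
        rw [lintegral_mul_const _ hm, ← positionIntegral_eq]
        by_cases hC : centroid C ∈ unitCube d
        · rw [hq, Set.indicator_of_mem hC, Set.indicator_of_mem (by exact hC)]; simp
        · rw [hq, Set.indicator_of_notMem hC, Set.indicator_of_notMem (by exact hC)]; simp
    _ = _ := lintegral_indicator (measurable_centroid measurableSet_unitCube) _

end Intensity

/-! ### From the typical cell to the zero cell: scaling and uniqueness -/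

theorem indicator_eq_indicator_of_iff {α β : Type*} {S : Set α} {S' : Set β}
    {f : α → ℝ≥0∞} {f' : β → ℝ≥0∞} {x : α} {y : β} (h : x ∈ S ↔ y ∈ S') (hf : f x = f' y) :
    S.indicator f x = S'.indicator f' y := by
  by_cases hx : x ∈ S
  · rw [Set.indicator_of_mem hx, Set.indicator_of_mem (h.1 hx), hf]
  · rw [Set.indicator_of_notMem hx, Set.indicator_of_notMem (fun hy => hx (h.2 hy))]

theorem measurable_centring :
    Measurable fun C : NonemptyCompacts (Space d) => translateSet (-centroid C) C :=
  measurable_translateSet.comp (measurable_centroid.neg.prodMk measurable_id)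

/-- The substitution `u = r • w` contributes the Jacobian `r ^ d`, and dilation about the origin
preserves whether the origin is covered. -/
theorem positionIntegral_dilateSet (φ : NonemptyCompacts (Space d) → ℝ≥0∞) {r : ℝ} (hr : 0 < r)
    (hφ : Measurable φ) (C : NonemptyCompacts (Space d)) :
    positionIntegral φ (dilateSet r C)
      = ENNReal.ofReal (r ^ d) * positionIntegral (fun D => φ (dilateSet r D)) C := by
  rw [positionIntegral_eq, positionIntegral_eq]
  set F := {D : NonemptyCompacts (Space d) | 0 ∈ D}.indicator φ
  have hF : Measurable F := hφ.indicator (measurableSet_mem_left 0)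
  have hFm : Measurable fun u : Space d => F (translateSet (-u) (dilateSet r C)) :=
    hF.comp (measurable_translateSet_neg.comp measurable_prodMk_left)
  have h1 : ∀ w : Space d, {D : NonemptyCompacts (Space d) | 0 ∈ D}.indicator
      (fun D => φ (dilateSet r D)) (translateSet (-w) C)
      = F (translateSet (-(r • w)) (dilateSet r C)) := by
    intro w
    rw [← smul_neg, ← dilateSet_translateSet]
    have h0 : (0 : Space d) ∈ dilateSet r (translateSet (-w) C)
        ↔ (0 : Space d) ∈ translateSet (-w) C := by
      rw [mem_dilateSet hr.ne', smul_zero]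
    exact indicator_eq_indicator_of_iff h0.symm rfl
  simp_rw [h1]
  have h2 := Measure.map_addHaar_smul (volume : Measure (Space d)) hr.ne'
  have h3 := lintegral_map (μ := (volume : Measure (Space d))) hFm
    (measurable_const_smul (M := ℝ) (α := Space d) r)
  rw [← h3]
  have h4 : Measure.map (fun u : Space d => r • u) volume
      = ENNReal.ofReal (r ^ d)⁻¹ • (volume : Measure (Space d)) := by
    rw [h2, finrank_euclideanSpace_fin, abs_of_pos (by positivity)]
  rw [h4, lintegral_smul_measure, smul_eq_mul, ← mul_assoc, ← ENNReal.ofReal_mul (by positivity),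
    mul_inv_cancel₀ (by positivity), ENNReal.ofReal_one, one_mul]

section Scaling

variable {Ω : Type*} [MeasurableSpace Ω] {P : Measure Ω} {T : Ω → Tessellation d}
  {Ω₁ : Type*} [MeasurableSpace Ω₁] {P₁ : Measure Ω₁} {T₁ : Ω₁ → Tessellation d}

/-- The unnormalised law of the typical cell. -/
noncomputable def typicalMeasure (P : Measure Ω) (T : Ω → Tessellation d) :
    Measure (NonemptyCompacts (Space d)) :=
  ((cellIntensity P T).restrict (centroid ⁻¹' unitCube d)).map
    fun C => translateSet (-centroid C) C

theorem typicalMeasure_apply (hT : Measurable T) {B : Set (NonemptyCompacts (Space d))}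
    (hB : MeasurableSet B) (h0 : tessellationIntensity P T ≠ 0)
    (hfin : tessellationIntensity P T ≠ ∞) :
    typicalMeasure P T B = tessellationIntensity P T * typicalCellLaw P T B := by
  have hB' := measurable_centring hB
  rw [typicalMeasure, Measure.map_apply measurable_centring hB, Measure.restrict_apply hB',
    cellIntensity_apply hT (hB'.inter (measurable_centroid measurableSet_unitCube)),
    typicalCellLaw, ENNReal.mul_div_cancel h0 hfin, Set.inter_comm]
  rfl

theorem setLIntegral_zero_mem_eq_typicalMeasure (hT : Measurable T)
    (hst : IsStationaryTessellation P T) (hfin : tessellationIntensity P T ≠ ∞)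
    {φ : NonemptyCompacts (Space d) → ℝ≥0∞} (hφ : Measurable φ) :
    ∫⁻ C in {C | 0 ∈ C}, φ C ∂cellIntensity P T
      = ∫⁻ C, positionIntegral φ C ∂typicalMeasure P T := by
  rw [setLIntegral_zero_mem hT hst hfin hφ, typicalMeasure,
    lintegral_map (measurable_positionIntegral hφ) measurable_centring]
  simp_rw [positionIntegral_translateSet]

/-- The zero cell inherits the scaling property of the typical cell. -/
theorem setLIntegral_zero_mem_scaling (hd : 1 ≤ d) {h : ℝ} (hh : 0 < h)
    (hT : Measurable T) (hst : IsStationaryTessellation P T)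
    (hγ : tessellationIntensity P T = ENNReal.ofReal (h ^ (-(d : ℝ))))
    (hT₁ : Measurable T₁) (hst₁ : IsStationaryTessellation P₁ T₁)
    (hγ₁ : tessellationIntensity P₁ T₁ = 1)
    (hsc : HasScalingProperty P T (h ^ (-(d : ℝ))) P₁ T₁)
    {φ : NonemptyCompacts (Space d) → ℝ≥0∞} (hφ : Measurable φ) :
    ∫⁻ C in {C | 0 ∈ C}, φ C ∂cellIntensity P T
      = ∫⁻ C in {C | 0 ∈ C}, φ (dilateSet h C) ∂cellIntensity P₁ T₁ := by
  have hγ0 : tessellationIntensity P T ≠ 0 := by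
    rw [hγ, ne_eq, ENNReal.ofReal_eq_zero, not_le]; positivity
  have hγf : tessellationIntensity P T ≠ ∞ := by rw [hγ]; exact ENNReal.ofReal_ne_top
  have hd' : (d : ℝ) ≠ 0 := by positivity
  -- Here `1 ≤ d` matters: for `d = 0` the exponent `-1 / d` would be `0`.
  have hr : (h ^ (-(d : ℝ))) ^ (-1 / (d : ℝ)) = h := by
    rw [← Real.rpow_mul hh.le, show -(d : ℝ) * (-1 / d) = 1 by field_simp, Real.rpow_one]
  -- Without normalisation the typical laws differ by the ratio `h⁻ᵈ` of the intensities, which will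
  -- cancel the Jacobian `hᵈ` of the position integral.
  have hm : typicalMeasure P T
      = ENNReal.ofReal (h ^ (-(d : ℝ))) • (typicalMeasure P₁ T₁).map (dilateSet h) := by
    ext B hB
    have hB' := measurable_dilateSet h hB
    rw [Measure.smul_apply, Measure.map_apply (measurable_dilateSet h) hB,
      typicalMeasure_apply hT hB hγ0 hγf, hsc B hB, hr,
      typicalMeasure_apply hT₁ hB' (by rw [hγ₁]; simp) (by rw [hγ₁]; simp), hγ, hγ₁, one_mul]
    rfl
  have hφh : Measurable fun C => φ (dilateSet h C) := hφ.comp (measurable_dilateSet h)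
  rw [setLIntegral_zero_mem_eq_typicalMeasure hT hst hγf hφ,
    setLIntegral_zero_mem_eq_typicalMeasure hT₁ hst₁ (by rw [hγ₁]; simp) hφh, hm, lintegral_smul_measure,
    lintegral_map (measurable_positionIntegral hφ) (measurable_dilateSet h)]
  simp_rw [positionIntegral_dilateSet φ hh hφ]
  rw [lintegral_const_mul _ (measurable_positionIntegral hφh),
    smul_eq_mul, ← mul_assoc, ← ENNReal.ofReal_mul (by positivity), Real.rpow_neg hh.le,
    Real.rpow_natCast, inv_mul_cancel₀ (by positivity), ENNReal.ofReal_one, one_mul]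

theorem setLIntegral_mem_eq_zero_mem (hT : Measurable T) (hst : IsStationaryTessellation P T)
    (x : Space d) {φ : NonemptyCompacts (Space d) → ℝ≥0∞} (hφ : Measurable φ) :
    ∫⁻ C in {C | x ∈ C}, φ (translateSet (-x) C) ∂cellIntensity P T
      = ∫⁻ C in {C | 0 ∈ C}, φ C ∂cellIntensity P T := by
  rw [← lintegral_indicator (measurableSet_mem_left x),
    ← lintegral_indicator (measurableSet_mem_left 0),
    ← lintegral_translateSet hT hst (-x) (hφ.indicator (measurableSet_mem_left 0))]
  refine lintegral_congr fun C => ?_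
  have h0 : (0 : Space d) ∈ translateSet (-x) C ↔ x ∈ C := by
    rw [mem_translateSet, sub_neg_eq_add, zero_add]
  exact indicator_eq_indicator_of_iff h0.symm rfl

/-- A given point lies in one cell on average. -/
theorem cellIntensity_mem (hT : Measurable T) (hst : IsStationaryTessellation P T)
    [IsProbabilityMeasure P] (hfin : tessellationIntensity P T ≠ ∞) (x : Space d) :
    cellIntensity P T {C | x ∈ C} = 1 := by
  have := sigmaFinite_cellIntensity hT hst hfin
  -- By stationarity the mean number of cells at `y` does not depend on `y`, so it equals its
  -- integral over the unit cube.
  have h1 : ∀ y : Space d, cellIntensity P T {C | y ∈ C} = cellIntensity P T {C | 0 ∈ C} := by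
    intro y
    have := setLIntegral_mem_eq_zero_mem hT hst y (φ := fun _ => 1) measurable_const
    simpa using this
  have h2 : ∫⁻ y in unitCube d, cellIntensity P T {C | y ∈ C}
      = ∫⁻ C : NonemptyCompacts (Space d),
        volume ((C : Set (Space d)) ∩ unitCube d) ∂cellIntensity P T := by
    have hS : MeasurableSet ({p : NonemptyCompacts (Space d) × Space d | p.2 ∈ p.1}) :=
      measurableSet_mem
    have e1 := Measure.prod_apply (μ := cellIntensity P T)
      (ν := (volume : Measure (Space d)).restrict (unitCube d)) hS
    have e2 := Measure.prod_apply_symm (μ := cellIntensity P T)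
      (ν := (volume : Measure (Space d)).restrict (unitCube d)) hS
    rw [e1] at e2
    refine Eq.trans e2.symm (lintegral_congr fun C => ?_)
    exact Measure.restrict_apply C.isCompact.measurableSet
  -- The cells cover the cube and overlap in null sets, so their volumes inside the cube add up to
  -- one.
  have h3 : ∀ t : Tessellation d, ∫⁻ C : NonemptyCompacts (Space d),
      volume ((C : Set (Space d)) ∩ unitCube d) ∂cellMeasure t = 1 := by
    intro t
    have hc := t.countable_cells
    rw [cellMeasure, lintegral_countable _ hc]
    simp only [Measure.count_singleton, mul_one]
    have hcu := hc.to_subtype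
    have h4 := measure_iUnion₀ (μ := volume) (f := fun C : t.cells =>
        ((C : NonemptyCompacts (Space d)) : Set (Space d)) ∩ unitCube d) ?_ ?_
    · rw [← h4, ← Set.iUnion_inter, ← volume_unitCube (d := d)]
      congr 1
      refine Set.inter_eq_right.2 fun u _ => ?_
      obtain ⟨C, hC, hu⟩ := t.cover u
      exact Set.mem_iUnion.2 ⟨⟨C, hC⟩, hu⟩
    · intro C D hCD
      refine measure_mono_null ?_ (t.volume_inter_eq_zero C.2 D.2 fun h => hCD (Subtype.ext h))
      rintro u ⟨hu1, hu2⟩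
      exact ⟨hu1.1, hu2.1⟩
    · exact fun C => (C.1.isCompact.measurableSet.inter measurableSet_unitCube).nullMeasurableSet
  rw [lintegral_cellIntensity hT (measurable_volume_inter measurableSet_unitCube)] at h2
  simp_rw [h3, h1] at h2
  rw [h1]
  simpa [volume_unitCube] using h2

/-- The number of cells at `x` is at least one by covering and has mean one, so it equals one almost
surely. -/
theorem ae_existsUnique_cell (hT : Measurable T) (hst : IsStationaryTessellation P T)
    [IsProbabilityMeasure P] (hfin : tessellationIntensity P T ≠ ∞) (x : Space d) :
    ∀ᵐ ω ∂P, ∃ C ∈ (T ω).cells, (T ω).cells ∩ {C | x ∈ C} = {C} := by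
  have h1 := cellIntensity_mem hT hst hfin x
  have hm := measurableSet_mem_left x
  have hmeas : Measurable fun ω => cellMeasure (T ω) {C | x ∈ C} :=
    (Measure.measurable_coe hm).comp (measurable_cellMeasure.comp hT)
  have h2 : ∫⁻ ω, cellMeasure (T ω) {C | x ∈ C} ∂P = 1 := by
    rw [← h1, cellIntensity_apply hT hm, meanCellCount]
    simp_rw [cellMeasure_apply _ hm]
  have h3 : ∀ ω, 1 ≤ cellMeasure (T ω) {C | x ∈ C} := by
    intro ω
    obtain ⟨C, hC, hx⟩ := (T ω).cover x
    rw [cellMeasure_apply _ hm]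
    have : (1 : ℕ∞) ≤ ((T ω).cells ∩ {C | x ∈ C}).encard :=
      Set.one_le_encard_iff_nonempty.2 ⟨C, hC, hx⟩
    simpa using ENat.toENNReal_le.2 this
  have h4 := ae_eq_of_ae_le_of_lintegral_le (μ := P) (f := fun _ => (1 : ℝ≥0∞))
    (Eventually.of_forall h3) (by simp) hmeas.aemeasurable (by rw [h2]; simp)
  filter_upwards [h4] with ω hω
  rw [cellMeasure_apply _ hm] at hω
  have h5 : ((T ω).cells ∩ {C | x ∈ C}).encard = 1 := by
    have : ((1 : ℕ∞) : ℝ≥0∞) = (((T ω).cells ∩ {C | x ∈ C}).encard : ℝ≥0∞) := by simpa using hω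
    exact (ENat.toENNReal_inj.1 this).symm
  obtain ⟨C, hC⟩ := Set.encard_eq_one.1 h5
  have : C ∈ (T ω).cells ∩ {C | x ∈ C} := hC ▸ rfl
  exact ⟨C, this.1, hC⟩

end Scaling

/-! ### Outradius and truncated volumes of convex cells -/

/-- The largest distance to the origin of a point of a compact set. -/
noncomputable def outradius (C : NonemptyCompacts (Space d)) : ℝ := dist C {0}

theorem measurable_outradius :
    Measurable (outradius : NonemptyCompacts (Space d) → ℝ) :=
  (continuous_id.dist continuous_const).measurable

theorem outradius_nonneg (C : NonemptyCompacts (Space d)) : 0 ≤ outradius C := dist_nonneg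

theorem norm_le_outradius {C : NonemptyCompacts (Space d)} {u : Space d} (hu : u ∈ C) :
    ‖u‖ ≤ outradius C := by
  have h := Metric.infDist_le_hausdorffDist_of_mem (s := (C : Set (Space d)))
    (t := (({0} : NonemptyCompacts (Space d)) : Set (Space d))) hu
    (edist_ne_top C {0})
  rw [NonemptyCompacts.coe_singleton, Metric.infDist_singleton, dist_zero_right] at h
  exact h

theorem outradius_le {C : NonemptyCompacts (Space d)} {R : ℝ} (h : ∀ u ∈ C, ‖u‖ ≤ R) :
    outradius C ≤ R := by
  obtain ⟨w, hw⟩ := C.nonempty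
  have hR : 0 ≤ R := (norm_nonneg w).trans (h w hw)
  refine Metric.hausdorffDist_le_of_mem_dist hR ?_ ?_
  · intro u hu
    exact ⟨0, by simp, by simpa using h u hu⟩
  · intro u hu
    have : u = 0 := by simpa using hu
    subst this
    exact ⟨w, hw, by simpa using h w hw⟩

theorem outradius_dilateSet_le {h : ℝ} (hh : 0 < h) (C : NonemptyCompacts (Space d)) :
    outradius (dilateSet h C) ≤ h * outradius C := by
  refine outradius_le ?_
  rintro _ ⟨u, hu, rfl⟩
  rw [norm_smul, Real.norm_of_nonneg hh.le]
  exact mul_le_mul_of_nonneg_left (norm_le_outradius hu) hh.le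

theorem le_outradius_dilateSet {h : ℝ} (hh : 0 < h) (C : NonemptyCompacts (Space d)) :
    h * outradius C ≤ outradius (dilateSet h C) := by
  rw [mul_comm, ← le_div_iff₀ hh]
  refine outradius_le fun u hu => ?_
  rw [le_div_iff₀ hh]
  have := norm_le_outradius (C := dilateSet h C) (u := h • u) ⟨u, hu, rfl⟩
  rwa [norm_smul, Real.norm_of_nonneg hh.le, mul_comm] at this

theorem outradius_dilateSet {h : ℝ} (hh : 0 < h) (C : NonemptyCompacts (Space d)) :
    outradius (dilateSet h C) = h * outradius C :=
  (outradius_dilateSet_le hh C).antisymm (le_outradius_dilateSet hh C)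

theorem outradius_le_diam {C : NonemptyCompacts (Space d)} (h : (0 : Space d) ∈ C) :
    outradius C ≤ Metric.diam (C : Set (Space d)) :=
  outradius_le fun u hu => by
    simpa using Metric.dist_le_diam_of_mem C.isCompact.isBounded hu h

theorem le_setLIntegral_cellMeasure {t : Tessellation d} {C : NonemptyCompacts (Space d)}
    (hC : C ∈ t.cells) {S : Set (NonemptyCompacts (Space d))} (hS : MeasurableSet S) (hCS : C ∈ S)
    (φ : NonemptyCompacts (Space d) → ℝ≥0∞) :
    φ C ≤ ∫⁻ D in S, φ D ∂cellMeasure t := by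
  rw [← lintegral_indicator hS]
  refine le_trans ?_ (le_lintegral_cellMeasure hC _)
  rw [Set.indicator_of_mem hCS]

theorem setLIntegral_cellMeasure_of_unique {t : Tessellation d}
    {C : NonemptyCompacts (Space d)} {S : Set (NonemptyCompacts (Space d))} (hS : MeasurableSet S)
    (h : t.cells ∩ S = {C}) (φ : NonemptyCompacts (Space d) → ℝ≥0∞) :
    ∫⁻ D in S, φ D ∂cellMeasure t = φ C := by
  rw [cellMeasure, Measure.restrict_restrict hS, Set.inter_comm, h, lintegral_singleton,
    Measure.count_singleton, mul_one]

theorem zeroCell_eq {t : Tessellation d} {C : NonemptyCompacts (Space d)}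
    (h : t.cells ∩ {C | 0 ∈ C} = {C}) : zeroCell t = C := by
  have hC : C ∈ t.cells ∩ {C | 0 ∈ C} := h ▸ rfl
  apply Set.Subset.antisymm
  · rintro u ⟨I, ⟨⟨D, hD, rfl⟩, h0⟩, hu⟩
    have : D ∈ t.cells ∩ {C | 0 ∈ C} := ⟨hD, h0⟩
    rw [h] at this
    rwa [← Set.mem_singleton_iff.1 this]
  · intro u hu
    exact ⟨C, ⟨⟨C, hC.1, rfl⟩, hC.2⟩, hu⟩

open scoped Pointwise in
theorem volume_dilateSet_inter_ball {h : ℝ} (hh : 0 < h) (C : NonemptyCompacts (Space d)) (r : ℝ) :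
    volume ((dilateSet h C : Set (Space d)) ∩ Metric.ball 0 r)
      = ENNReal.ofReal (h ^ d) * volume ((C : Set (Space d)) ∩ Metric.ball 0 (r / h)) := by
  have e : (dilateSet h C : Set (Space d)) ∩ Metric.ball 0 r
      = h • ((C : Set (Space d)) ∩ Metric.ball 0 (r / h)) := by
    rw [Set.smul_set_inter₀ hh.ne', smul_ball hh.ne', smul_zero, Real.norm_of_nonneg hh.le,
      mul_div_cancel₀ _ hh.ne']
    rfl
  rw [e, Measure.addHaar_smul, finrank_euclideanSpace_fin, abs_of_pos (by positivity)]

theorem volume_translateSet_inter_ball (x : Space d) (C : NonemptyCompacts (Space d)) (r : ℝ) :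
    volume ((translateSet (-x) C : Set (Space d)) ∩ Metric.ball 0 r)
      = volume ((C : Set (Space d)) ∩ Metric.ball x r) := by
  have e : (C : Set (Space d)) ∩ Metric.ball x r
      = (fun u => u - x) ⁻¹' ((translateSet (-x) C : Set (Space d)) ∩ Metric.ball 0 r) := by
    ext u
    rw [coe_translateSet']
    simp [dist_eq_norm]
  rw [e, (measurePreserving_sub_right volume x).measure_preimage
    ((translateSet (-x) C).isCompact.measurableSet.inter measurableSet_ball).nullMeasurableSet]

open scoped Pointwise in
-- Shrinking towards the origin stays inside a convex set that contains it. So the part in the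
-- larger ball fits into the dilate by `s / s'` of the part in the smaller one.
theorem volume_inter_ball_le_of_convex {C : Set (Space d)} (hC : Convex ℝ C) (h0 : 0 ∈ C)
    {s s' : ℝ} (hs' : 0 < s') (hs : s' ≤ s) :
    volume (C ∩ Metric.ball 0 s) ≤ ENNReal.ofReal ((s / s') ^ d) * volume (C ∩ Metric.ball 0 s') := by
  have hs0 : 0 < s := hs'.trans_le hs
  have e : C ∩ Metric.ball 0 s ⊆ (s / s') • (C ∩ Metric.ball 0 s') := by
    rintro u ⟨hu, hus⟩
    refine ⟨(s' / s) • u, ⟨?_, ?_⟩, ?_⟩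
    · exact hC.smul_mem_of_zero_mem h0 hu ⟨by positivity, (div_le_one hs0).2 hs⟩
    · rw [mem_ball_zero_iff] at hus ⊢
      rw [norm_smul, Real.norm_of_nonneg (by positivity), div_mul_eq_mul_div, div_lt_iff₀ hs0]
      exact mul_lt_mul_of_pos_left hus hs'
    · simp only [smul_smul]
      rw [div_mul_div_cancel₀ hs'.ne', div_self hs0.ne', one_smul]
  refine (measure_mono e).trans ?_
  rw [Measure.addHaar_smul, finrank_euclideanSpace_fin, abs_of_pos (by positivity)]

/-! ### Moments and mean inverse volumes of the zero cell -/

section Model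

variable {Ω : Type*} [MeasurableSpace Ω] {P : Measure Ω} {T : Ω → Tessellation d}
  {Ω₁ : Type*} [MeasurableSpace Ω₁] {P₁ : Measure Ω₁} {T₁ : Ω₁ → Tessellation d}

/-- Moments of the outradius of the zero cell. -/
noncomputable def outradiusMoment (P : Measure Ω) (T : Ω → Tessellation d) (k : ℕ) : ℝ≥0∞ :=
  ∫⁻ C in {C | 0 ∈ C}, ENNReal.ofReal (outradius C ^ k) ∂cellIntensity P T

/-- The mean inverse volume of the part of the zero cell in a ball. -/
noncomputable def inverseVolume (P : Measure Ω) (T : Ω → Tessellation d) (s : ℝ) : ℝ≥0∞ :=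
  ∫⁻ C : NonemptyCompacts (Space d) in {C | 0 ∈ C},
    (volume ((C : Set (Space d)) ∩ Metric.ball 0 s))⁻¹ ∂cellIntensity P T

theorem measurable_outradius_pow (k : ℕ) : Measurable fun C : NonemptyCompacts (Space d) =>
    ENNReal.ofReal (outradius C ^ k) :=
  (measurable_outradius.pow_const k).ennreal_ofReal

theorem measurable_inv_volume (x : Space d) (s : ℝ) :
    Measurable fun C : NonemptyCompacts (Space d) =>
      (volume ((C : Set (Space d)) ∩ Metric.ball x s))⁻¹ :=
  (measurable_volume_inter measurableSet_ball).inv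

/-- Regularity concerns the union of all cells at the origin. Almost surely this is a single cell,
and its outradius is at most its diameter because it contains the origin. -/
theorem outradiusMoment_ne_top [IsProbabilityMeasure P] (hT : Measurable T)
    (hst : IsStationaryTessellation P T) (hfin : tessellationIntensity P T ≠ ∞)
    (hreg : IsRegularTessellation P T) (k : ℕ) : outradiusMoment P T k ≠ ∞ := by
  refine ne_top_of_le_ne_top (hreg k).ne ?_
  rw [outradiusMoment, setLIntegral_cellIntensity hT (measurableSet_mem_left 0)
    (measurable_outradius_pow k)]
  refine lintegral_mono_ae ?_
  filter_upwards [ae_existsUnique_cell hT hst hfin 0] with ω ⟨C, hC, hu⟩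
  have h0 : C ∈ (T ω).cells ∩ {C | 0 ∈ C} := hu ▸ rfl
  rw [setLIntegral_cellMeasure_of_unique (measurableSet_mem_left 0) hu, zeroCell_eq hu]
  exact ENNReal.ofReal_le_ofReal (pow_le_pow_left₀ (outradius_nonneg C) (outradius_le_diam h0.2) k)

theorem inverseVolume_antitone : Antitone (inverseVolume P T) := by
  intro s s' hs
  refine lintegral_mono fun C => ENNReal.inv_le_inv.2 (measure_mono ?_)
  exact Set.inter_subset_inter_right _ (Metric.ball_subset_ball hs)

/-- With `inverseVolume_antitone` this makes finiteness independent of the positive truncation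
radius. -/
theorem inverseVolume_le (hT : Measurable T) {s s' : ℝ} (hs' : 0 < s') (hs : s' ≤ s) :
    inverseVolume P T s' ≤ ENNReal.ofReal ((s / s') ^ d) * inverseVolume P T s := by
  have hs0 : 0 < s := hs'.trans_le hs
  rw [inverseVolume, inverseVolume, setLIntegral_cellIntensity hT (measurableSet_mem_left 0)
    (measurable_inv_volume 0 _), setLIntegral_cellIntensity hT (measurableSet_mem_left 0)
    (measurable_inv_volume 0 _), ← lintegral_const_mul' _ _ ENNReal.ofReal_ne_top]
  refine lintegral_mono fun ω => ?_
  rw [← lintegral_const_mul' _ _ ENNReal.ofReal_ne_top]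
  refine lintegral_mono_ae ?_
  rw [ae_restrict_iff' (measurableSet_mem_left 0)]
  refine ae_cellMeasure fun C hC h0 => ?_
  have h1 := volume_inter_ball_le_of_convex ((T ω).convex_of_mem hC) h0 hs' hs
  have hpos : ENNReal.ofReal ((s / s') ^ d) ≠ 0 := by
    rw [ne_eq, ENNReal.ofReal_eq_zero, not_le]; positivity
  have h2 := ENNReal.inv_le_inv.2 h1
  rw [ENNReal.mul_inv (Or.inl hpos) (Or.inl ENNReal.ofReal_ne_top)] at h2
  calc (volume ((C : Set (Space d)) ∩ Metric.ball 0 s'))⁻¹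
      = ENNReal.ofReal ((s / s') ^ d) * ((ENNReal.ofReal ((s / s') ^ d))⁻¹
        * (volume ((C : Set (Space d)) ∩ Metric.ball 0 s'))⁻¹) := by
        rw [← mul_assoc, ENNReal.mul_inv_cancel hpos ENNReal.ofReal_ne_top, one_mul]
    _ ≤ _ := mul_le_mul_right h2 _

/-- Replacing the cell at `x` by its part in a ball only increases the inverse volume, and summing
over all cells at `x` dominates the term of any one of them. No uniqueness is needed in this
direction. -/
theorem le_inverseVolume_of_subset (hT : Measurable T) (hst : IsStationaryTessellation P T)
    {x : Space d} {r : ℝ} {A : Tessellation d → Set (Space d)}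
    (hA : ∀ t : Tessellation d, ∀ C : NonemptyCompacts (Space d), C ∈ t.cells → x ∈ C →
      (C : Set (Space d)) ∩ Metric.ball x r ⊆ A t) :
    ∫⁻ ω, (volume (A (T ω)))⁻¹ ∂P ≤ inverseVolume P T r := by
  rw [inverseVolume, ← setLIntegral_mem_eq_zero_mem hT hst x (measurable_inv_volume 0 r)]
  simp_rw [volume_translateSet_inter_ball]
  rw [setLIntegral_cellIntensity hT (measurableSet_mem_left x) (measurable_inv_volume x _)]
  refine lintegral_mono fun ω => ?_
  obtain ⟨C, hC, hx⟩ := (T ω).cover x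
  refine le_trans ?_ (le_setLIntegral_cellMeasure hC (measurableSet_mem_left x) hx _)
  exact ENNReal.inv_le_inv.2 (measure_mono (hA _ C hC hx))

/-- The opposite direction: here the sum over the cells at `x` must reduce to one term, which holds
almost surely. -/
theorem inverseVolume_le_of_subset [IsProbabilityMeasure P] (hT : Measurable T)
    (hst : IsStationaryTessellation P T) (hfin : tessellationIntensity P T ≠ ∞)
    {x : Space d} {R : ℝ} {A : Tessellation d → Set (Space d)}
    (hA : ∀ t, A t ⊆ Metric.ball x R)
    (hA' : ∀ t, ∀ u ∈ A t, ∃ C ∈ t.cells, x ∈ C ∧ u ∈ C) :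
    inverseVolume P T R ≤ ∫⁻ ω, (volume (A (T ω)))⁻¹ ∂P := by
  rw [inverseVolume, ← setLIntegral_mem_eq_zero_mem hT hst x (measurable_inv_volume 0 R)]
  simp_rw [volume_translateSet_inter_ball]
  rw [setLIntegral_cellIntensity hT (measurableSet_mem_left x) (measurable_inv_volume x _)]
  refine lintegral_mono_ae ?_
  filter_upwards [ae_existsUnique_cell hT hst hfin x] with ω ⟨C, hC, hu⟩
  rw [setLIntegral_cellMeasure_of_unique (measurableSet_mem_left x) hu]
  refine ENNReal.inv_le_inv.2 (measure_mono fun u hu' => ⟨?_, hA _ hu'⟩)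
  obtain ⟨D, hD, hxD, huD⟩ := hA' _ u hu'
  have : D ∈ (T ω).cells ∩ {C | x ∈ C} := ⟨hD, hxD⟩
  rw [hu] at this
  rwa [← Set.mem_singleton_iff.1 this]

/-- Markov's inequality: if `A` leaves the ball, then some cell at `x` has outradius at least `r` as
seen from `x`. Working with a pointwise bound avoids any measurability of the escape event. -/
theorem lintegral_not_subset_ball_le (hT : Measurable T) (hst : IsStationaryTessellation P T)
    {x : Space d} {r : ℝ} {A : Tessellation d → Set (Space d)} (hr : 0 < r)
    (hA' : ∀ t, ∀ u ∈ A t, ∃ C ∈ t.cells, x ∈ C ∧ u ∈ C) (k : ℕ) :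
    ∫⁻ ω, {t | ¬ A t ⊆ Metric.ball x r}.indicator 1 (T ω) ∂P
      ≤ ENNReal.ofReal ((r ^ k)⁻¹) * outradiusMoment P T k := by
  have hm : Measurable fun C : NonemptyCompacts (Space d) =>
      ENNReal.ofReal (outradius (translateSet (-x) C) ^ k) :=
    (measurable_outradius_pow k).comp (measurable_translateSet_const (-x))
  rw [outradiusMoment, ← setLIntegral_mem_eq_zero_mem hT hst x (measurable_outradius_pow k),
    setLIntegral_cellIntensity hT (measurableSet_mem_left x) hm,
    ← lintegral_const_mul' _ _ ENNReal.ofReal_ne_top]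
  refine lintegral_mono fun ω => ?_
  by_cases h : ¬ A (T ω) ⊆ Metric.ball x r
  · rw [Set.indicator_of_mem h]
    obtain ⟨u, hu, hur⟩ := Set.not_subset.1 h
    obtain ⟨C, hC, hx, huC⟩ := hA' _ u hu
    have h1 := le_setLIntegral_cellMeasure hC (measurableSet_mem_left x) hx
      (fun C => ENNReal.ofReal (outradius (translateSet (-x) C) ^ k))
    have h2 : r ≤ outradius (translateSet (-x) C) := by
      have h3 : u - x ∈ translateSet (-x) C := by
        rw [mem_translateSet]; simpa using huC
      have h4 := norm_le_outradius h3
      rw [Metric.mem_ball, not_lt, dist_eq_norm] at hur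
      exact hur.trans h4
    calc (1 : ℝ≥0∞) = ENNReal.ofReal ((r ^ k)⁻¹) * ENNReal.ofReal (r ^ k) := by
          rw [← ENNReal.ofReal_mul (by positivity), inv_mul_cancel₀ (by positivity),
            ENNReal.ofReal_one]
      _ ≤ _ := mul_le_mul_right ((ENNReal.ofReal_le_ofReal
          (pow_le_pow_left₀ hr.le h2 k)).trans h1) _
  · rw [Set.indicator_of_notMem h]
    exact zero_le

theorem outradiusMoment_scaling (hd : 1 ≤ d) {h : ℝ} (hh : 0 < h)
    (hT : Measurable T) (hst : IsStationaryTessellation P T)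
    (hγ : tessellationIntensity P T = ENNReal.ofReal (h ^ (-(d : ℝ))))
    (hT₁ : Measurable T₁) (hst₁ : IsStationaryTessellation P₁ T₁)
    (hγ₁ : tessellationIntensity P₁ T₁ = 1)
    (hsc : HasScalingProperty P T (h ^ (-(d : ℝ))) P₁ T₁) (k : ℕ) :
    outradiusMoment P T k = ENNReal.ofReal (h ^ k) * outradiusMoment P₁ T₁ k := by
  rw [outradiusMoment, setLIntegral_zero_mem_scaling hd hh hT hst hγ hT₁ hst₁ hγ₁ hsc
    (measurable_outradius_pow k), outradiusMoment, ← lintegral_const_mul' _ _ ENNReal.ofReal_ne_top]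
  refine lintegral_congr fun C => ?_
  rw [outradius_dilateSet hh, mul_pow, ENNReal.ofReal_mul (by positivity)]

theorem inverseVolume_scaling (hd : 1 ≤ d) {h : ℝ} (hh : 0 < h)
    (hT : Measurable T) (hst : IsStationaryTessellation P T)
    (hγ : tessellationIntensity P T = ENNReal.ofReal (h ^ (-(d : ℝ))))
    (hT₁ : Measurable T₁) (hst₁ : IsStationaryTessellation P₁ T₁)
    (hγ₁ : tessellationIntensity P₁ T₁ = 1)
    (hsc : HasScalingProperty P T (h ^ (-(d : ℝ))) P₁ T₁) (r : ℝ) :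
    inverseVolume P T r = ENNReal.ofReal ((h ^ d)⁻¹) * inverseVolume P₁ T₁ (r / h) := by
  rw [inverseVolume, setLIntegral_zero_mem_scaling hd hh hT hst hγ hT₁ hst₁ hγ₁ hsc
    (measurable_inv_volume 0 r), inverseVolume, ← lintegral_const_mul' _ _ ENNReal.ofReal_ne_top]
  refine lintegral_congr fun C => ?_
  have hpos : ENNReal.ofReal (h ^ d) ≠ 0 := by
    rw [ne_eq, ENNReal.ofReal_eq_zero, not_le]; positivity
  rw [volume_dilateSet_inter_ball hh, ENNReal.mul_inv (Or.inl hpos) (Or.inl ENNReal.ofReal_ne_top),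
    ENNReal.ofReal_inv_of_pos (by positivity)]

end Model

/-! ### Cells and subcells of the window -/

theorem inter_ball_subset_partitionCell {t : Tessellation d} {W : Set (Space d)}
    {part : Tessellation d → Set (Space d) → Set (Set (Space d))}
    (hpart : part = windowCells ∨ part = windowSubcells) {x : Space d} {r : ℝ}
    (hr : 0 < r) (hW : Metric.ball x r ⊆ W) {C : NonemptyCompacts (Space d)} (hC : C ∈ t.cells)
    (hx : x ∈ C) : (C : Set (Space d)) ∩ Metric.ball x r ⊆ partitionCell (part t W) x := by
  have hxW : x ∈ W := hW (Metric.mem_ball_self hr)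
  have hxC : x ∈ (C : Set (Space d)) ∩ W := ⟨hx, hxW⟩
  rintro u ⟨huC, hur⟩
  rcases hpart with rfl | rfl
  · exact ⟨(C : Set (Space d)) ∩ W, ⟨⟨C, hC, rfl, x, hxC⟩, hxC⟩, huC, hW hur⟩
  · refine ⟨connectedComponentIn ((C : Set (Space d)) ∩ W) x, ⟨⟨C, hC, x, hxC, rfl⟩,
      mem_connectedComponentIn hxC⟩, ?_⟩
    -- A convex set is connected, so the part of `C` in the ball lies in the connected component of
    -- `x`.
    have hconv : Convex ℝ ((C : Set (Space d)) ∩ Metric.ball x r) :=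
      (t.convex_of_mem hC).inter (convex_ball x r)
    exact hconv.isPreconnected.subset_connectedComponentIn ⟨hx, Metric.mem_ball_self hr⟩
      (Set.inter_subset_inter_right _ hW) ⟨huC, hur⟩

theorem exists_cell_of_mem_partitionCell {t : Tessellation d} {W : Set (Space d)}
    {part : Tessellation d → Set (Space d) → Set (Set (Space d))}
    (hpart : part = windowCells ∨ part = windowSubcells) {x u : Space d}
    (hu : u ∈ partitionCell (part t W) x) : u ∈ W ∧ ∃ C ∈ t.cells, x ∈ C ∧ u ∈ C := by
  obtain ⟨I, ⟨hI, hxI⟩, huI⟩ := hu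
  rcases hpart with rfl | rfl
  · obtain ⟨C, hC, rfl, -⟩ := hI
    exact ⟨huI.2, C, hC, hxI.1, huI.1⟩
  · obtain ⟨C, hC, w, hw, rfl⟩ := hI
    have h := connectedComponentIn_subset ((C : Set (Space d)) ∩ W) w
    exact ⟨(h huI).2, C, hC, (h hxI).1, (h huI).1⟩

/-! ### Measurability and second moments of point counts -/

theorem measurable_encard_inter {B : Set (Space d)} (hB : MeasurableSet B) :
    Measurable fun ξ : PointConfiguration d => ((ξ.points ∩ B).encard : ℝ≥0∞) := by
  refine Measurable.mono (ma := MeasurableSpace.comap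
    (fun ξ : PointConfiguration d => ((ξ.points ∩ B).encard : ℝ≥0∞)) inferInstance)
    (comap_measurable _) ?_ le_rfl
  exact le_iSup (fun B : {B : Set (Space d) // MeasurableSet B} =>
    MeasurableSpace.comap
      (fun ξ : PointConfiguration d => ((ξ.points ∩ B.1).encard : ℝ≥0∞)) inferInstance) ⟨B, hB⟩

theorem PointConfiguration.measurableSet_inter (ξ : PointConfiguration d) {W : Set (Space d)}
    (hW : Bornology.IsBounded W) : MeasurableSet (ξ.points ∩ W) :=
  (ξ.locallyFinite W hW).measurableSet

/-- Joint measurability of a count in a random set: the points in the bounded window form a finite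
kernel, and the count is the kernel mass of a section of `S`. -/
theorem measurable_encard_section {τ : Type*} [MeasurableSpace τ] {W : Set (Space d)}
    (hW : Bornology.IsBounded W) (hWm : MeasurableSet W) {S : Set (τ × Space d)}
    (hS : MeasurableSet S) :
    Measurable fun p : PointConfiguration d × τ =>
      ((p.1.points ∩ {u | (p.2, u) ∈ S ∧ u ∈ W}).encard : ℝ≥0∞) := by
  have happ : ∀ (ξ : PointConfiguration d) {B : Set (Space d)}, MeasurableSet B →
      Measure.count.restrict (ξ.points ∩ W) B = ((ξ.points ∩ (B ∩ W)).encard : ℝ≥0∞) := by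
    intro ξ B hB
    rw [Measure.restrict_apply hB, Measure.count_apply (hB.inter (ξ.measurableSet_inter hW)),
      Set.inter_left_comm]
  let κ : Kernel (PointConfiguration d × τ) (Space d) :=
    ⟨fun p => Measure.count.restrict (p.1.points ∩ W), by
      refine Measure.measurable_of_measurable_coe _ fun B hB => ?_
      simp_rw [happ _ hB]
      exact (measurable_encard_inter (hB.inter hWm)).comp measurable_fst⟩
  have hκ : ∀ p, IsFiniteMeasure (κ p) := by
    intro p
    refine ⟨?_⟩
    change Measure.count.restrict (p.1.points ∩ W) Set.univ < ∞
    rw [Measure.restrict_apply_univ]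
    exact Measure.count_apply_lt_top.2 (p.1.locallyFinite W hW)
  have hS' : MeasurableSet {q : (PointConfiguration d × τ) × Space d | (q.1.2, q.2) ∈ S} :=
    ((measurable_snd.comp measurable_fst).prodMk measurable_snd) hS
  have h := Kernel.measurable_kernel_prodMk_left_of_finite hS' hκ
  have e : (fun p : PointConfiguration d × τ => κ p (Prod.mk p ⁻¹'
      {q : (PointConfiguration d × τ) × Space d | (q.1.2, q.2) ∈ S})) = fun p =>
      ((p.1.points ∩ {u | (p.2, u) ∈ S ∧ u ∈ W}).encard : ℝ≥0∞) := by
    funext p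
    exact happ p.1 (measurable_prodMk_left hS')
  rwa [e] at h

/-- The identity `N(N - 1) + N = N²`, which links the second moment of a count to the second order
intensity. -/
theorem encard_offDiag_add {s : Set (Space d)} (hs : s.Finite) :
    (({p : Space d × Space d | p.1 ∈ s ∧ p.2 ∈ s ∧ p.1 ≠ p.2}.encard : ℕ∞) : ℝ≥0∞)
      + (s.encard : ℝ≥0∞) = (s.encard : ℝ≥0∞) ^ 2 := by
  classical
  lift s to Finset (Space d) using hs
  have h : {p : Space d × Space d | p.1 ∈ (s : Set (Space d)) ∧ p.2 ∈ (s : Set (Space d)) ∧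
      p.1 ≠ p.2} = (s.offDiag : Set (Space d × Space d)) := by
    ext p; simp
  rw [h, Set.encard_coe_eq_coe_finsetCard, Set.encard_coe_eq_coe_finsetCard, Finset.offDiag_card]
  have h2 : s.card * s.card - s.card + s.card = s.card ^ 2 := by
    rw [sq]; exact Nat.sub_add_cancel (Nat.le_mul_self _)
  rw [ENat.toENNReal_coe, ENat.toENNReal_coe]
  exact_mod_cast h2

section PointProcess

variable {Ω : Type*} [MeasurableSpace Ω] {P : Measure Ω} {X : Ω → PointConfiguration d}

/-- Where the intensity is positive, `ρ₂ = g ρ ρ ≤ ρ ρ + |g - 1| a² K²`. Where it vanishes, `g`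
carries no information, but almost surely no point lies there, so this set is removed before the
density is used. -/
theorem lintegral_offDiag_le {lam : Space d → ℝ} (hlam : Measurable lam) (h0 : ∀ u, 0 ≤ lam u)
    {a K c : ℝ} (ha : 0 < a) (hK : ∀ u, lam u ≤ K)
    (hint : HasIntensityFunction P X fun u => a * lam u) (hX : Measurable X)
    {g : Space d × Space d → ℝ} (hg : HasPairCorrelation P X (fun u => a * lam u) g)
    {A : Set (Space d)} (hA : MeasurableSet A)
    (hgA : ENNReal.ofReal a * ∫⁻ p in A ×ˢ A, ENNReal.ofReal |g p - 1|
      ≤ ENNReal.ofReal c * volume A) :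
    ∫⁻ ω, (({p : Space d × Space d | p.1 ∈ (X ω).points ∩ A ∧ p.2 ∈ (X ω).points ∩ A ∧
        p.1 ≠ p.2}).encard : ℝ≥0∞) ∂P
      ≤ (∫⁻ u in A, ENNReal.ofReal (a * lam u)) ^ 2
        + ENNReal.ofReal (a * K ^ 2) * (ENNReal.ofReal c * volume A) := by
  obtain ⟨hgm, ρ₂, ⟨hρm, hρ0, hρ⟩, hgρ⟩ := hg
  set N : Set (Space d) := {u | lam u = 0} with hN
  have hNm : MeasurableSet N := hlam (measurableSet_singleton 0)
  have hAN : MeasurableSet (A \ N) := hA.diff hNm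
  have h1 : ∀ᵐ ω ∂P, (X ω).points ∩ (A ∩ N) = ∅ := by
    have e := hint (A ∩ N) (hA.inter hNm)
    have e2 : ∫⁻ u in A ∩ N, ENNReal.ofReal (a * lam u) = 0 := by
      rw [setLIntegral_congr_fun (g := fun _ => 0) (hA.inter hNm)]
      · simp
      · rintro u ⟨-, hu⟩
        have hu' : lam u = 0 := hu
        simp [hu']
    have hm : Measurable fun ω => (((X ω).points ∩ (A ∩ N)).encard : ℝ≥0∞) :=
      (measurable_encard_inter (hA.inter hNm)).comp hX
    rw [e2, lintegral_eq_zero_iff hm] at e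
    filter_upwards [e] with ω hω
    simpa using hω
  have h2 : ∫⁻ ω, (({p : Space d × Space d | p.1 ∈ (X ω).points ∩ A ∧ p.2 ∈ (X ω).points ∩ A ∧
        p.1 ≠ p.2}).encard : ℝ≥0∞) ∂P = ∫⁻ p in (A \ N) ×ˢ (A \ N), ENNReal.ofReal (ρ₂ p) := by
    rw [← hρ _ _ hAN hAN]
    refine lintegral_congr_ae ?_
    filter_upwards [h1] with ω hω
    congr 2
    ext p
    have h3 : ∀ u ∈ (X ω).points, u ∈ A → u ∉ N := fun u hu huA huN =>
      (Set.ext_iff.1 hω u).1 ⟨hu, huA, huN⟩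
    constructor
    · rintro ⟨⟨q1, q2⟩, ⟨q3, q4⟩, q5⟩
      exact ⟨q1, q3, q5, ⟨q2, h3 _ q1 q2⟩, ⟨q4, h3 _ q3 q4⟩⟩
    · rintro ⟨q1, q3, q5, ⟨q2, -⟩, ⟨q4, -⟩⟩
      exact ⟨⟨q1, q2⟩, ⟨q3, q4⟩, q5⟩
  have hρ' : Measurable fun u => ENNReal.ofReal (a * lam u) := by fun_prop
  rw [h2]
  calc ∫⁻ p in (A \ N) ×ˢ (A \ N), ENNReal.ofReal (ρ₂ p)
      ≤ ∫⁻ p in (A \ N) ×ˢ (A \ N), (ENNReal.ofReal (a * lam p.1) * ENNReal.ofReal (a * lam p.2)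
          + ENNReal.ofReal (a ^ 2 * K ^ 2) * ENNReal.ofReal |g p - 1|) := by
        refine setLIntegral_mono' (hAN.prod hAN) ?_
        rintro ⟨u, v⟩ ⟨⟨-, hu⟩, ⟨-, hv⟩⟩
        have hu' : lam u ≠ 0 := hu
        have hv' : lam v ≠ 0 := hv
        have hne : a * lam u * (a * lam v) ≠ 0 :=
          mul_ne_zero (mul_ne_zero ha.ne' hu') (mul_ne_zero ha.ne' hv')
        have e := hgρ u v hne
        rw [eq_div_iff hne] at e
        have hle : a * lam u * (a * lam v) ≤ a ^ 2 * K ^ 2 := by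
          have := mul_le_mul (hK u) (hK v) (h0 v) ((h0 u).trans (hK u))
          calc a * lam u * (a * lam v) = a ^ 2 * (lam u * lam v) := by ring
            _ ≤ a ^ 2 * (K * K) := mul_le_mul_of_nonneg_left this (sq_nonneg a)
            _ = _ := by ring
        have hpos : 0 ≤ a * lam u * (a * lam v) :=
          mul_nonneg (mul_nonneg ha.le (h0 u)) (mul_nonneg ha.le (h0 v))
        rw [← ENNReal.ofReal_mul (mul_nonneg ha.le (h0 u)), ← ENNReal.ofReal_mul (by positivity),
          ← ENNReal.ofReal_add hpos (by positivity)]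
        refine ENNReal.ofReal_le_ofReal ?_
        calc ρ₂ (u, v) = a * lam u * (a * lam v) + (g (u, v) - 1) * (a * lam u * (a * lam v)) := by
              rw [← e]; ring
          _ ≤ a * lam u * (a * lam v) + |g (u, v) - 1| * (a ^ 2 * K ^ 2) := by
              refine add_le_add_right ?_ _
              exact (mul_le_mul_of_nonneg_right (le_abs_self _) hpos).trans
                (mul_le_mul_of_nonneg_left hle (abs_nonneg _))
          _ = _ := by ring
    _ ≤ ∫⁻ p in A ×ˢ A, (ENNReal.ofReal (a * lam p.1) * ENNReal.ofReal (a * lam p.2)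
          + ENNReal.ofReal (a ^ 2 * K ^ 2) * ENNReal.ofReal |g p - 1|) :=
        lintegral_mono_set (Set.prod_mono Set.sdiff_subset Set.sdiff_subset)
    _ = (∫⁻ u in A, ENNReal.ofReal (a * lam u)) ^ 2
          + ENNReal.ofReal (a ^ 2 * K ^ 2) * ∫⁻ p in A ×ˢ A, ENNReal.ofReal |g p - 1| := by
        rw [lintegral_add_left (by fun_prop), lintegral_const_mul' _ _ ENNReal.ofReal_ne_top,
          Measure.volume_eq_prod, ← Measure.prod_restrict,
          lintegral_prod_mul hρ'.aemeasurable hρ'.aemeasurable, ← sq]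
    _ ≤ _ := by
        refine add_le_add_right ?_ _
        rw [show a ^ 2 * K ^ 2 = a * K ^ 2 * a by ring, ENNReal.ofReal_mul (by positivity), mul_assoc]
        exact mul_le_mul_right hgA _

/-- Bias and variance of the normalised count on a fixed set; `b` bounds the oscillation of the
intensity about the target `l`, hence the bias. -/
theorem mse_bound [IsProbabilityMeasure P] {lam : Space d → ℝ} (hlam : Measurable lam)
    (h0 : ∀ u, 0 ≤ lam u)
    {a K c : ℝ} (ha : 0 < a) (hc : 0 < c) (hK : ∀ u, lam u ≤ K)
    (hint : HasIntensityFunction P X fun u => a * lam u) (hX : Measurable X)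
    {g : Space d × Space d → ℝ} (hg : HasPairCorrelation P X (fun u => a * lam u) g)
    {A : Set (Space d)} (hA : MeasurableSet A) (hAb : Bornology.IsBounded A)
    (hgA : ENNReal.ofReal a * ∫⁻ p in A ×ˢ A, ENNReal.ofReal |g p - 1|
      ≤ ENNReal.ofReal c * volume A)
    {l b : ℝ} (hl : 0 ≤ l) (hb : ∀ u ∈ A, |lam u - l| ≤ b) (hb0 : 0 ≤ b) :
    ∫⁻ ω, ENNReal.ofReal ((((X ω).points ∩ A).ncard / (a * volume.real A) - l) ^ 2) ∂P
      ≤ ENNReal.ofReal (K + K ^ 2 * c + 1) * (ENNReal.ofReal a * volume A)⁻¹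
        + ENNReal.ofReal (b ^ 2) := by
  have hK0 : 0 ≤ K := (h0 0).trans (hK 0)
  -- On a null set the right side is infinite because `0⁻¹ = ∞`; the summand `1` keeps its
  -- coefficient nonzero even if `K = 0`.
  by_cases hv0 : volume A = 0
  · rw [hv0, mul_zero, ENNReal.inv_zero, ENNReal.mul_top, top_add]
    · exact le_top
    · rw [ne_eq, ENNReal.ofReal_eq_zero, not_le]; positivity
  have hvf : volume A ≠ ∞ := hAb.measure_lt_top.ne
  set v := volume.real A with hv
  have hvpos : 0 < v := ENNReal.toReal_pos hv0 hvf
  have hvA : volume A = ENNReal.ofReal v := (ENNReal.ofReal_toReal hvf).symm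
  set mE := ∫⁻ u in A, ENNReal.ofReal (a * lam u) with hmE
  have hconst : ∀ r : ℝ, ∫⁻ _ in A, ENNReal.ofReal (a * r) = ENNReal.ofReal (a * v * r) := by
    intro r
    rw [setLIntegral_const, hvA, ← ENNReal.ofReal_mul' hvpos.le]
    congr 1; ring
  have hm1 : mE ≤ ENNReal.ofReal (a * v * K) := by
    rw [← hconst]
    exact lintegral_mono fun u =>
      ENNReal.ofReal_le_ofReal (mul_le_mul_of_nonneg_left (hK u) ha.le)
  have hm2 : mE ≤ ENNReal.ofReal (a * v * (l + b)) := by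
    rw [← hconst]
    refine setLIntegral_mono' hA fun u hu => ENNReal.ofReal_le_ofReal
      (mul_le_mul_of_nonneg_left ?_ ha.le)
    have := (abs_le.1 (hb u hu)).2
    linarith
  have hm3 : ENNReal.ofReal (a * v * (l - b)) ≤ mE := by
    rw [← hconst]
    refine setLIntegral_mono' hA fun u hu => ENNReal.ofReal_le_ofReal
      (mul_le_mul_of_nonneg_left ?_ ha.le)
    have := (abs_le.1 (hb u hu)).1
    linarith
  have hmf : mE ≠ ∞ := ne_top_of_le_ne_top ENNReal.ofReal_ne_top hm1
  set m := mE.toReal with hm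
  have hmm : mE = ENNReal.ofReal m := (ENNReal.ofReal_toReal hmf).symm
  have hm0 : 0 ≤ m := ENNReal.toReal_nonneg
  have hm1' : m ≤ a * v * K := ENNReal.toReal_le_of_le_ofReal (by positivity) hm1
  have hm2' : m ≤ a * v * (l + b) := ENNReal.toReal_le_of_le_ofReal (by positivity) hm2
  have hm3' : a * v * (l - b) ≤ m := by
    rw [hmm] at hm3
    exact (ENNReal.ofReal_le_ofReal_iff hm0).1 hm3
  set s := a * v * l with hs
  have hs0 : 0 ≤ s := by positivity
  have hNm : Measurable fun ω => (((X ω).points ∩ A).encard : ℝ≥0∞) :=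
    (measurable_encard_inter hA).comp hX
  have hfin : ∀ ω, ((X ω).points ∩ A).Finite := fun ω => (X ω).locallyFinite A hAb
  have hN : ∀ ω, (((X ω).points ∩ A).encard : ℝ≥0∞)
      = ENNReal.ofReal (((X ω).points ∩ A).ncard : ℝ) := by
    intro ω
    rw [← (hfin ω).cast_ncard_eq, ENat.toENNReal_coe, ENNReal.ofReal_natCast]
  have hEN : ∫⁻ ω, (((X ω).points ∩ A).encard : ℝ≥0∞) ∂P = mE := hint A hA
  have hoff := lintegral_offDiag_le hlam h0 ha hK hint hX hg hA hgA
  have hEN2 : ∫⁻ ω, (((X ω).points ∩ A).encard : ℝ≥0∞) ^ 2 ∂P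
      ≤ ENNReal.ofReal (m ^ 2 + a * K ^ 2 * (c * v) + m) := by
    simp_rw [← encard_offDiag_add (hfin _)]
    rw [lintegral_add_right _ hNm, hEN]
    refine (add_le_add_left hoff _).trans_eq ?_
    rw [← hmE, hmm, hvA, ← ENNReal.ofReal_pow hm0, ← ENNReal.ofReal_mul hc.le,
      ← ENNReal.ofReal_mul (by positivity), ← ENNReal.ofReal_add (by positivity) (by positivity),
      ← ENNReal.ofReal_add (by positivity) (by positivity)]
  set L := ∫⁻ ω, ENNReal.ofReal ((((X ω).points ∩ A).ncard - s) ^ 2) ∂P with hL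
  -- The square `(N - s)²` is expanded with the cross term on the left, which avoids subtraction in
  -- `ℝ≥0∞`.
  have hLeq : L + ENNReal.ofReal (2 * s * m)
      = ∫⁻ ω, (((X ω).points ∩ A).encard : ℝ≥0∞) ^ 2 ∂P + ENNReal.ofReal (s ^ 2) := by
    have e1 : ENNReal.ofReal (2 * s * m)
        = ∫⁻ ω, ENNReal.ofReal (2 * s) * (((X ω).points ∩ A).encard : ℝ≥0∞) ∂P := by
      rw [lintegral_const_mul _ hNm, hEN, hmm, ← ENNReal.ofReal_mul (by positivity)]
    have e2 : ENNReal.ofReal (s ^ 2) = ∫⁻ _, ENNReal.ofReal (s ^ 2) ∂P := by simp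
    rw [e1, e2, hL, ← lintegral_add_right _ (hNm.const_mul _),
      ← lintegral_add_right _ measurable_const]
    refine lintegral_congr fun ω => ?_
    rw [hN, ← ENNReal.ofReal_pow (by positivity), ← ENNReal.ofReal_mul (by positivity),
      ← ENNReal.ofReal_add (by positivity) (by positivity),
      ← ENNReal.ofReal_add (by positivity) (by positivity)]
    congr 1; ring
  have hLle : L + ENNReal.ofReal (2 * s * m)
      ≤ ENNReal.ofReal (m ^ 2 + a * K ^ 2 * (c * v) + m + s ^ 2) := by
    rw [hLeq, ENNReal.ofReal_add (p := m ^ 2 + a * K ^ 2 * (c * v) + m) (by positivity)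
      (by positivity)]
    exact add_le_add_left hEN2 _
  have hLf : L ≠ ∞ :=
    ne_top_of_le_ne_top ENNReal.ofReal_ne_top (le_self_add.trans hLle)
  have hLr : L.toReal ≤ (a * v * b) ^ 2 + a * v * (K + K ^ 2 * c) := by
    have h1 : L.toReal + 2 * s * m ≤ m ^ 2 + a * K ^ 2 * (c * v) + m + s ^ 2 := by
      have := ENNReal.toReal_mono ENNReal.ofReal_ne_top hLle
      rwa [ENNReal.toReal_add hLf ENNReal.ofReal_ne_top, ENNReal.toReal_ofReal (by positivity),
        ENNReal.toReal_ofReal (by positivity)] at this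
    -- This is the squared bias of the count. The remaining terms `a K² c v + m` are at most `a v (K
    -- + K² c)`, because `m ≤ a v K`.
    have h2 : (m - s) ^ 2 ≤ (a * v * b) ^ 2 := by
      refine sq_le_sq' ?_ ?_ <;> rw [hs] <;> linarith
    nlinarith
  have hLe : L ≤ ENNReal.ofReal ((a * v * b) ^ 2 + a * v * (K + K ^ 2 * c)) := by
    rw [← ENNReal.ofReal_toReal hLf]
    exact ENNReal.ofReal_le_ofReal hLr
  have hscale : ∫⁻ ω, ENNReal.ofReal ((((X ω).points ∩ A).ncard / (a * v) - l) ^ 2) ∂P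
      = ENNReal.ofReal (((a * v) ^ 2)⁻¹) * L := by
    rw [hL, ← lintegral_const_mul' _ _ ENNReal.ofReal_ne_top]
    refine lintegral_congr fun ω => ?_
    rw [← ENNReal.ofReal_mul (by positivity)]
    congr 1
    rw [hs]; field_simp
  rw [hscale, hvA, ← ENNReal.ofReal_mul ha.le, ← ENNReal.ofReal_inv_of_pos (by positivity),
    ← ENNReal.ofReal_mul (by positivity), ← ENNReal.ofReal_add (by positivity) (by positivity)]
  refine (mul_le_mul_right hLe _).trans ?_
  rw [← ENNReal.ofReal_mul (by positivity)]
  refine ENNReal.ofReal_le_ofReal ?_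
  have e : ((a * v) ^ 2)⁻¹ * ((a * v * b) ^ 2 + a * v * (K + K ^ 2 * c))
      = (K + K ^ 2 * c) * (a * v)⁻¹ + b ^ 2 := by
    field_simp
    ring
  rw [e]
  have : 0 ≤ (a * v)⁻¹ := by positivity
  nlinarith

end PointProcess

/-! ### Mean square error of a tree on a random cell -/

section Tree

variable {Ω : Type*} [MeasurableSpace Ω] {P : Measure Ω} {X : Ω → PointConfiguration d}
  {T : Ω → Tessellation d}

/-- The relative number of points of a configuration in a set. -/
noncomputable def relativeCount (a : ℝ) (ξ : PointConfiguration d) (A : Set (Space d)) : ℝ :=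
  ((ξ.points ∩ A).ncard : ℝ) / (a * volume.real A)

theorem measurable_relativeCount (a : ℝ) {W : Set (Space d)} (hWb : Bornology.IsBounded W)
    (hWm : MeasurableSet W) {A : Tessellation d → Set (Space d)} (hAW : ∀ t, A t ⊆ W)
    (hA : MeasurableSet {p : Tessellation d × Space d | p.2 ∈ A p.1}) :
    Measurable fun p : PointConfiguration d × Tessellation d => relativeCount a p.1 (A p.2) := by
  have h1 := measurable_encard_section hWb hWm hA
  have h2 : Measurable fun t => volume (A t) := measurable_measure_prodMk_left hA
  have h3 : ∀ p : PointConfiguration d × Tessellation d,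
      ((p.1.points ∩ {u | (p.2, u) ∈ {p : Tessellation d × Space d | p.2 ∈ A p.1} ∧ u ∈ W}).encard
        : ℝ≥0∞).toReal = ((p.1.points ∩ A p.2).ncard : ℝ) := by
    intro p
    have e : {u | (p.2, u) ∈ {p : Tessellation d × Space d | p.2 ∈ A p.1} ∧ u ∈ W} = A p.2 := by
      ext u
      exact ⟨fun h => h.1, fun h => ⟨h, hAW _ h⟩⟩
    rw [e, ← (p.1.locallyFinite (A p.2) (hWb.subset (hAW _))).cast_ncard_eq]
    simp
  have h4 := h1.ennreal_toReal
  simp_rw [h3] at h4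
  exact h4.div ((h2.comp measurable_snd).ennreal_toReal.const_mul a)

/-- By independence the tessellation can be frozen and the bound for fixed cells integrated over its
law. -/
theorem tree_mse_le [IsProbabilityMeasure P] {lam : Space d → ℝ} (hlam : Measurable lam)
    (h0 : ∀ u, 0 ≤ lam u) {a K c : ℝ} (ha : 0 < a) (hc : 0 < c) (hK : ∀ u, lam u ≤ K)
    (hint : HasIntensityFunction P X fun u => a * lam u) (hX : Measurable X)
    {g : Space d × Space d → ℝ} (hg : HasPairCorrelation P X (fun u => a * lam u) g)
    {W : Set (Space d)} (hWb : Bornology.IsBounded W) (hWm : MeasurableSet W)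
    (hgA : ∀ A ⊆ W, MeasurableSet A → ENNReal.ofReal a * ∫⁻ p in A ×ˢ A, ENNReal.ofReal |g p - 1|
      ≤ ENNReal.ofReal c * volume A)
    (hT : Measurable T) (hXT : IndepFun X T P)
    {A : Tessellation d → Set (Space d)} (hAW : ∀ t, A t ⊆ W)
    (hA : MeasurableSet {p : Tessellation d × Space d | p.2 ∈ A p.1})
    {x : Space d} {r : ℝ} (hr : ∀ u ∈ Metric.ball x r, lam u = lam x) :
    ∫⁻ ω, ENNReal.ofReal ((relativeCount a (X ω) (A (T ω)) - lam x) ^ 2) ∂P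
      ≤ ENNReal.ofReal (K + K ^ 2 * c + 1)
          * ∫⁻ ω, (ENNReal.ofReal a * volume (A (T ω)))⁻¹ ∂P
        + ENNReal.ofReal (K ^ 2)
          * ∫⁻ ω, {t | ¬ A t ⊆ Metric.ball x r}.indicator 1 (T ω) ∂P := by
  have hK0 : 0 ≤ K := (h0 0).trans (hK 0)
  have hF : Measurable fun p : PointConfiguration d × Tessellation d =>
      ENNReal.ofReal ((relativeCount a p.1 (A p.2) - lam x) ^ 2) :=
    (((measurable_relativeCount a hWb hWm hAW hA).sub_const _).pow_const 2).ennreal_ofReal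
  have hAm : ∀ t, MeasurableSet (A t) := fun t => measurable_prodMk_left (x := t) hA
  have hvol : Measurable fun t => (ENNReal.ofReal a * volume (A t))⁻¹ :=
    ((measurable_measure_prodMk_left hA).const_mul _).inv
  have hprod := (indepFun_iff_map_prod_eq_prod_map_map hX.aemeasurable hT.aemeasurable).1 hXT
  have := Measure.isProbabilityMeasure_map (μ := P) hX.aemeasurable
  have := Measure.isProbabilityMeasure_map (μ := P) hT.aemeasurable
  have e1 : ∫⁻ ω, ENNReal.ofReal ((relativeCount a (X ω) (A (T ω)) - lam x) ^ 2) ∂P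
      = ∫⁻ t, ∫⁻ ω, ENNReal.ofReal ((relativeCount a (X ω) (A t) - lam x) ^ 2) ∂P ∂(P.map T) := by
    rw [← lintegral_map (μ := P) (g := fun ω => (X ω, T ω)) hF (hX.prodMk hT), hprod,
      lintegral_prod_symm _ hF.aemeasurable]
    refine lintegral_congr fun t => ?_
    exact lintegral_map (hF.comp measurable_prodMk_right) hX
  rw [e1]
  calc ∫⁻ t, ∫⁻ ω, ENNReal.ofReal ((relativeCount a (X ω) (A t) - lam x) ^ 2) ∂P ∂(P.map T)
      ≤ ∫⁻ t, (ENNReal.ofReal (K + K ^ 2 * c + 1) * (ENNReal.ofReal a * volume (A t))⁻¹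
          + ENNReal.ofReal (K ^ 2) * {t | ¬ A t ⊆ Metric.ball x r}.indicator 1 t) ∂(P.map T) := by
        refine lintegral_mono fun t => ?_
        -- Inside the ball the intensity equals its value at `x`, so `b = 0`; otherwise the trivial
        -- bound `b = K` applies.
        by_cases ht : A t ⊆ Metric.ball x r
        · rw [Set.indicator_of_notMem (by simpa using ht), mul_zero]
          have := mse_bound hlam h0 ha hc hK hint hX hg (hAm t) (hWb.subset (hAW t))
            (hgA _ (hAW t) (hAm t)) (h0 x) (b := 0) (fun u hu => by rw [hr u (ht hu)]; simp) le_rfl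
          simpa [relativeCount] using this
        · rw [Set.indicator_of_mem (by simpa using ht), Pi.one_apply, mul_one]
          refine mse_bound hlam h0 ha hc hK hint hX hg (hAm t) (hWb.subset (hAW t))
            (hgA _ (hAW t) (hAm t)) (h0 x) (b := K) (fun u _ => ?_) hK0
          rw [abs_le]
          constructor <;> linarith [h0 u, h0 x, hK u, hK x]
    _ = ENNReal.ofReal (K + K ^ 2 * c + 1)
          * ∫⁻ t, (ENNReal.ofReal a * volume (A t))⁻¹ ∂(P.map T)
        + ENNReal.ofReal (K ^ 2)
          * ∫⁻ t, {t | ¬ A t ⊆ Metric.ball x r}.indicator 1 t ∂(P.map T) := by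
        rw [lintegral_add_left (hvol.const_mul _), lintegral_const_mul' _ _ ENNReal.ofReal_ne_top,
          lintegral_const_mul' _ _ ENNReal.ofReal_ne_top]
    _ ≤ _ := by
        rw [lintegral_map hvol hT]
        -- The escape event is not shown to be measurable, so it is transferred from the law of `T`
        -- by an inequality, which points the right way.
        exact add_le_add_right (mul_le_mul_right (lintegral_map_le _ _) _) _

theorem integrable_and_integral_le_of_lintegral_sq_le {Y : Ω → ℝ} (hY : Measurable Y) {C : ℝ}
    (hC : 0 ≤ C) (h : ∫⁻ ω, ENNReal.ofReal (Y ω ^ 2) ∂P ≤ ENNReal.ofReal C) :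
    Integrable (fun ω => Y ω ^ 2) P ∧ ∫ ω, Y ω ^ 2 ∂P ≤ C := by
  have hm : AEStronglyMeasurable (fun ω => Y ω ^ 2) P := (hY.pow_const 2).aestronglyMeasurable
  have h0 : 0 ≤ᵐ[P] fun ω => Y ω ^ 2 := Eventually.of_forall fun ω => sq_nonneg _
  refine ⟨(lintegral_ofReal_ne_top_iff_integrable hm h0).1
    (ne_top_of_le_ne_top ENNReal.ofReal_ne_top h), ?_⟩
  rw [integral_eq_lintegral_of_nonneg_ae h0 hm]
  exact ENNReal.toReal_le_of_le_ofReal hC h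

end Tree

/-! ### Averaging, finitely many indices, and local constancy -/

/-- Convexity of the square bounds the left side by the mean of the squares, and `1 / M ≤ 1`. -/
theorem sq_mean_sub_le {M : ℕ} (hM : 1 ≤ M) (y : Fin M → ℝ) (l : ℝ) :
    ((∑ i, y i) / M - l) ^ 2 ≤ ∑ i, (y i - l) ^ 2 := by
  have hM' : (1 : ℝ) ≤ M := by exact_mod_cast hM
  have hM0 : (M : ℝ) ≠ 0 := by positivity
  have e : (∑ i, y i) / M - l = (∑ i, (y i - l)) / M := by
    rw [Finset.sum_sub_distrib]; simp; field_simp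
  rw [e]
  have h := sum_div_card_sq_le_sum_sq_div_card (s := Finset.univ) (f := fun i => y i - l)
  simp only [Finset.card_univ, Fintype.card_fin] at h
  refine h.trans (div_le_self (Finset.sum_nonneg fun i _ => sq_nonneg _) hM')

/-- A bounded sequence that is eventually at most a positive one is dominated by it throughout. -/
theorem exists_const_of_eventually_le {p : ℕ → ℝ≥0∞} {q : ℕ → ℝ} (hq : ∀ n, 0 < q n)
    (hp : ∀ n, p n ≤ 1) {C : ℝ} (h : ∀ᶠ n in atTop, p n ≤ ENNReal.ofReal (C * q n)) :
    ∃ C' : ℝ, 0 ≤ C' ∧ ∀ n, p n ≤ ENNReal.ofReal (C' * q n) := by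
  obtain ⟨N, hN⟩ := eventually_atTop.1 h
  refine ⟨|C| + ∑ n ∈ Finset.range N, (q n)⁻¹, ?_, fun n => ?_⟩
  · exact add_nonneg (abs_nonneg _) (Finset.sum_nonneg fun n _ => (inv_pos.2 (hq n)).le)
  have hs : 0 ≤ ∑ n ∈ Finset.range N, (q n)⁻¹ :=
    Finset.sum_nonneg fun n _ => (inv_pos.2 (hq n)).le
  by_cases hn : N ≤ n
  · refine (hN n hn).trans (ENNReal.ofReal_le_ofReal (mul_le_mul_of_nonneg_right ?_ (hq n).le))
    linarith [le_abs_self C]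
  · refine (hp n).trans ?_
    rw [← ENNReal.ofReal_one]
    refine ENNReal.ofReal_le_ofReal ?_
    have h1 : (q n)⁻¹ ≤ ∑ n ∈ Finset.range N, (q n)⁻¹ :=
      Finset.single_le_sum (f := fun n => (q n)⁻¹) (fun n _ => (inv_pos.2 (hq n)).le)
        (Finset.mem_range.2 (not_le.1 hn))
    calc (1 : ℝ) = (q n)⁻¹ * q n := (inv_mul_cancel₀ (hq n).ne').symm
      _ ≤ _ := mul_le_mul_of_nonneg_right (by linarith [abs_nonneg C]) (hq n).le

/-- If the cell at `x` shrinks while its mean inverse content vanishes, the normalisation is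
eventually at least one. -/
theorem eventually_one_le {Ω : ℕ → Type*} [∀ n, MeasurableSpace (Ω n)] {P : ∀ n, Measure (Ω n)}
    [∀ n, IsProbabilityMeasure (P n)] {a : ℕ → ℝ} {x : Space d}
    {A : ∀ n, Ω n → Set (Space d)} (hAm : ∀ n, Measurable fun ω => volume (A n ω))
    (hAb : ∀ n ω, Bornology.IsBounded (A n ω)) (hx : ∀ n ω, x ∈ A n ω)
    (hdiam : Tendsto (fun n => P n {ω | 1 ≤ Metric.diam (A n ω)}) atTop (𝓝 0))
    (hinv : Tendsto (fun n => ∫⁻ ω, (ENNReal.ofReal (a n) * volume (A n ω))⁻¹ ∂(P n))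
      atTop (𝓝 0)) :
    ∀ᶠ n in atTop, 1 ≤ a n := by
  set V := volume (Metric.closedBall x 1)
  have hVf : V ≠ ∞ := Metric.isBounded_closedBall.measure_lt_top.ne
  have hVi : V⁻¹ ≠ 0 := ENNReal.inv_ne_zero.2 hVf
  have h1 : ∀ᶠ n in atTop, P n {ω | 1 ≤ Metric.diam (A n ω)} < 2⁻¹ :=
    hdiam.eventually_lt_const (by simp)
  have h2 : ∀ᶠ n in atTop, ∫⁻ ω, (ENNReal.ofReal (a n) * volume (A n ω))⁻¹ ∂(P n) < V⁻¹ * 2⁻¹ :=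
    hinv.eventually_lt_const (ENNReal.mul_pos hVi (by simp))
  filter_upwards [h1, h2] with n hn1 hn2
  by_contra! han
  -- If `a < 1`, a cell of diameter below one lies in the unit ball about `x`, so its inverse
  -- content is at least `V⁻¹`. Thus `E` and the event of large diameter exhaust the space, although
  -- each has probability below one half.
  set E := {ω | V⁻¹ ≤ (ENNReal.ofReal (a n) * volume (A n ω))⁻¹}
  have hmk : V⁻¹ * P n E ≤ _ := mul_meas_ge_le_lintegral ((hAm n).const_mul _).inv V⁻¹
  have hE : P n E < 2⁻¹ := by
    by_contra! hE
    exact absurd ((mul_le_mul_right hE V⁻¹).trans hmk) (not_le.2 hn2)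
  have hcov : (Set.univ : Set (Ω n)) ⊆ E ∪ {ω | 1 ≤ Metric.diam (A n ω)} := by
    intro ω _
    by_cases hω : 1 ≤ Metric.diam (A n ω)
    · exact Or.inr hω
    · refine Or.inl (ENNReal.inv_le_inv.2 ?_)
      have hsub : A n ω ⊆ Metric.closedBall x 1 := fun u hu =>
        (Metric.dist_le_diam_of_mem (hAb n ω) hu (hx n ω)).trans (not_le.1 hω).le
      calc ENNReal.ofReal (a n) * volume (A n ω) ≤ 1 * V :=
            mul_le_mul' (ENNReal.ofReal_le_one.2 han.le) (measure_mono hsub)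
        _ = V := one_mul V
  have h3 : (1 : ℝ≥0∞) < 1 := by
    calc (1 : ℝ≥0∞) = P n Set.univ := measure_univ.symm
      _ ≤ P n E + P n {ω | 1 ≤ Metric.diam (A n ω)} :=
          (measure_mono hcov).trans (measure_union_le _ _)
      _ < 2⁻¹ + 2⁻¹ := ENNReal.add_lt_add hE hn1
      _ = 1 := ENNReal.inv_two_add_inv_two
  exact lt_irrefl _ h3

/-- Two elements of `{0, 1}` at distance less than one coincide. -/
theorem exists_ball_eq_of_binary {z : Space d → ℝ} {x : Space d} {W : Set (Space d)} {r : ℝ}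
    (hr : 0 < r) (hW : Metric.ball x r ⊆ W) (hbin : z '' W = {0, 1}) (hzc : ContinuousAt z x) :
    ∃ r' : ℝ, 0 < r' ∧ ∀ u ∈ Metric.ball x r', z u = z x := by
  obtain ⟨δ, hδ, h⟩ := Metric.continuousAt_iff.1 hzc 1 one_pos
  refine ⟨min δ r, lt_min hδ hr, fun u hu => ?_⟩
  rw [Metric.mem_ball, lt_min_iff] at hu
  have h1 := h hu.1
  have hu' : z u = 0 ∨ z u = 1 := by
    have : z u ∈ ({0, 1} : Set ℝ) := hbin ▸ ⟨u, hW hu.2, rfl⟩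
    simpa using this
  have hx' : z x = 0 ∨ z x = 1 := by
    have : z x ∈ ({0, 1} : Set ℝ) := hbin ▸ ⟨x, hW (Metric.mem_ball_self hr), rfl⟩
    simpa using this
  rw [Real.dist_eq] at h1
  rcases hu' with hu' | hu' <;> rcases hx' with hx' | hx' <;> rw [hu', hx'] at h1 <;> norm_num at h1 <;>
    rw [hu', hx']

/-! ### Uniform bounds along the sequence of tessellations -/

section Model

variable {Ω : ℕ → Type*} [∀ n, MeasurableSpace (Ω n)] {P : ∀ n, Measure (Ω n)}
  [∀ n, IsProbabilityMeasure (P n)] {T : ∀ n, Ω n → Tessellation d}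
  {Ω₁ : Type*} [MeasurableSpace Ω₁] {P₁ : Measure Ω₁} {T₁ : Ω₁ → Tessellation d}

theorem exists_inverse_content_bound (hd : 1 ≤ d) {a h : ℕ → ℝ} (ha : ∀ n, 0 < a n)
    (hh : ∀ n, 0 < h n) (hhb : BddAbove (Set.range h))
    (hT₁ : Measurable T₁) (hst₁ : IsStationaryTessellation P₁ T₁)
    (hγ₁ : tessellationIntensity P₁ T₁ = 1)
    (hT : ∀ n, Measurable (T n)) (hst : ∀ n, IsStationaryTessellation (P n) (T n))
    (hγ : ∀ n, tessellationIntensity (P n) (T n) = ENNReal.ofReal (h n ^ (-(d : ℝ))))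
    (hsc : ∀ n, HasScalingProperty (P n) (T n) (h n ^ (-(d : ℝ))) P₁ T₁)
    {W : ℕ → Set (Space d)} (hWb : ∀ n, Bornology.IsBounded (W n)) {x : Space d} {r : ℝ}
    (hr : 0 < r) {A : ℕ → Tessellation d → Set (Space d)} (hAW : ∀ n t, A n t ⊆ W n)
    (hlow : ∀ n t, ∀ C : NonemptyCompacts (Space d), C ∈ t.cells → x ∈ C →
      (C : Set (Space d)) ∩ Metric.ball x r ⊆ A n t)
    (hup : ∀ n t, ∀ u ∈ A n t, ∃ C ∈ t.cells, x ∈ C ∧ u ∈ C)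
    (hinv : Tendsto (fun n => ∫⁻ ω, (ENNReal.ofReal (a n) * volume (A n (T n ω)))⁻¹ ∂(P n))
      atTop (𝓝 0)) :
    ∃ C : ℝ, 0 ≤ C ∧ ∀ n, ∫⁻ ω, (ENNReal.ofReal (a n) * volume (A n (T n ω)))⁻¹ ∂(P n)
      ≤ ENNReal.ofReal (C * (a n * h n ^ d)⁻¹) := by
  have hpos : ∀ n, ENNReal.ofReal (a n) ≠ 0 := fun n => by
    rw [ne_eq, ENNReal.ofReal_eq_zero, not_le]; exact ha n
  have hfac : ∀ n, ∫⁻ ω, (ENNReal.ofReal (a n) * volume (A n (T n ω)))⁻¹ ∂(P n)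
      = ENNReal.ofReal (a n)⁻¹ * ∫⁻ ω, (volume (A n (T n ω)))⁻¹ ∂(P n) := by
    intro n
    rw [← lintegral_const_mul' _ _ ENNReal.ofReal_ne_top]
    refine lintegral_congr fun ω => ?_
    rw [ENNReal.mul_inv (Or.inl (hpos n)) (Or.inl ENNReal.ofReal_ne_top),
      ENNReal.ofReal_inv_of_pos (ha n)]
  -- The limit serves only to provide one index with finite mean inverse content. The window at this
  -- index is bounded, which makes the mean inverse volume of the model of intensity one finite at
  -- radius `R / h n₀`.
  obtain ⟨n₀, hn₀⟩ := (hinv.eventually_lt_const (u := ∞) (by simp)).exists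
  obtain ⟨R, hR, hWR⟩ := (hWb n₀).subset_ball_lt 0 x
  have hfin₀ : inverseVolume P₁ T₁ (R / h n₀) ≠ ∞ := by
    intro htop
    have h1 := inverseVolume_le_of_subset (hT n₀) (hst n₀) (by rw [hγ]; exact ENNReal.ofReal_ne_top)
      (fun t => (hAW n₀ t).trans hWR) (hup n₀)
    rw [inverseVolume_scaling hd (hh n₀) (hT n₀) (hst n₀) (hγ n₀) hT₁ hst₁ hγ₁ (hsc n₀), htop,
      ENNReal.mul_top, top_le_iff] at h1
    · rw [hfac, h1, ENNReal.mul_top] at hn₀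
      · exact lt_irrefl _ hn₀
      · rw [ne_eq, ENNReal.ofReal_eq_zero, not_le]; exact inv_pos.2 (ha n₀)
    · rw [ne_eq, ENNReal.ofReal_eq_zero, not_le]; exact inv_pos.2 (pow_pos (hh n₀) d)
  obtain ⟨H, hH⟩ := hhb
  have hH' : ∀ n, h n ≤ H := fun n => hH ⟨n, rfl⟩
  have hHpos : 0 < H := (hh 0).trans_le (hH' 0)
  -- Finiteness passes from `R / h n₀` down to the minimum of the two radii by convexity, and up to
  -- `r / H` by monotonicity.
  have hfin : inverseVolume P₁ T₁ (r / H) ≠ ∞ := by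
    have hs : 0 < min (r / H) (R / h n₀) := lt_min (div_pos hr hHpos) (div_pos hR (hh n₀))
    refine ne_top_of_le_ne_top (ENNReal.mul_ne_top ENNReal.ofReal_ne_top hfin₀)
      ((inverseVolume_antitone (min_le_left _ _)).trans
        (inverseVolume_le hT₁ hs (min_le_right _ _)))
  refine ⟨(inverseVolume P₁ T₁ (r / H)).toReal, ENNReal.toReal_nonneg, fun n => ?_⟩
  have h1 : ∫⁻ ω, (volume (A n (T n ω)))⁻¹ ∂(P n)
      ≤ ENNReal.ofReal ((h n ^ d)⁻¹) * inverseVolume P₁ T₁ (r / H) := by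
    refine (le_inverseVolume_of_subset (hT n) (hst n) (hlow n)).trans ?_
    rw [inverseVolume_scaling hd (hh n) (hT n) (hst n) (hγ n) hT₁ hst₁ hγ₁ (hsc n)]
    -- After rescaling, the radius is `r / h n ≥ r / H`, so a single constant serves for all `n`.
    exact mul_le_mul_right (inverseVolume_antitone
      (div_le_div_of_nonneg_left hr.le (hh n) (hH' n))) _
  rw [hfac, ENNReal.ofReal_mul ENNReal.toReal_nonneg, ENNReal.ofReal_toReal hfin, mul_inv,
    ENNReal.ofReal_mul (inv_pos.2 (ha n)).le, mul_comm, ← mul_rotate']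
  refine (mul_le_mul_left h1 _).trans_eq ?_
  ring

theorem exists_escape_bound (hd : 1 ≤ d) {a h : ℕ → ℝ} (ha : ∀ n, 0 < a n)
    (ha1 : ∀ᶠ n in atTop, 1 ≤ a n) (hh : ∀ n, 0 < h n)
    {ε : ℝ} (hε : 0 < ε) (hha : ∀ n, h n < a n ^ (-ε))
    (hT₁ : Measurable T₁) (hst₁ : IsStationaryTessellation P₁ T₁)
    (hγ₁ : tessellationIntensity P₁ T₁ = 1)
    (hT : ∀ n, Measurable (T n)) (hst : ∀ n, IsStationaryTessellation (P n) (T n))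
    (hγ : ∀ n, tessellationIntensity (P n) (T n) = ENNReal.ofReal (h n ^ (-(d : ℝ))))
    (hsc : ∀ n, HasScalingProperty (P n) (T n) (h n ^ (-(d : ℝ))) P₁ T₁)
    (hreg : IsRegularTessellation (P 0) (T 0)) {x : Space d} {r : ℝ}
    (hr : 0 < r) {A : ℕ → Tessellation d → Set (Space d)}
    (hup : ∀ n t, ∀ u ∈ A n t, ∃ C ∈ t.cells, x ∈ C ∧ u ∈ C) :
    ∃ C : ℝ, 0 ≤ C ∧ ∀ n, ∫⁻ ω, {t | ¬ A n t ⊆ Metric.ball x r}.indicator 1 (T n ω) ∂(P n)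
      ≤ ENNReal.ofReal (C * (a n * h n ^ d)⁻¹) := by
  -- The order of the moment: `ε k > 1` makes `hᵏ` decay at least like `1 / a`.
  obtain ⟨k, hk⟩ := exists_nat_gt ε⁻¹
  have hfin : outradiusMoment P₁ T₁ k ≠ ∞ := by
    intro htop
    have h1 := outradiusMoment_ne_top (hT 0) (hst 0) (by rw [hγ]; exact ENNReal.ofReal_ne_top)
      hreg k
    rw [outradiusMoment_scaling hd (hh 0) (hT 0) (hst 0) (hγ 0) hT₁ hst₁ hγ₁ (hsc 0), htop,
      ENNReal.mul_top] at h1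
    · exact h1 rfl
    · rw [ne_eq, ENNReal.ofReal_eq_zero, not_le]; exact pow_pos (hh 0) k
  refine exists_const_of_eventually_le (C := (r ^ k)⁻¹ * (outradiusMoment P₁ T₁ k).toReal)
    (fun n => inv_pos.2 (mul_pos (ha n) (pow_pos (hh n) d))) (fun n => ?_) ?_
  · calc ∫⁻ ω, {t | ¬ A n t ⊆ Metric.ball x r}.indicator 1 (T n ω) ∂(P n)
        ≤ ∫⁻ _, 1 ∂(P n) := lintegral_mono fun ω => Set.indicator_le_self' (fun _ _ => zero_le) _
      _ = 1 := by simp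
  · filter_upwards [ha1] with n hn
    refine (lintegral_not_subset_ball_le (hT n) (hst n) hr (hup n) k).trans ?_
    rw [outradiusMoment_scaling hd (hh n) (hT n) (hst n) (hγ n) hT₁ hst₁ hγ₁ (hsc n), mul_comm
      (ENNReal.ofReal (h n ^ k)), ← mul_assoc, ENNReal.ofReal_mul (by positivity),
      ENNReal.ofReal_mul (by positivity), ENNReal.ofReal_toReal hfin]
    refine mul_le_mul_right (ENNReal.ofReal_le_ofReal ?_) _
    have hpd := pow_pos (hh n) d
    -- The Markov factor `hᵏ` is thus at most `1/(a hᵈ)`; lowering the exponent to `-1` uses `a ≥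
    -- 1`.
    have h1 : h n ^ d * h n ^ k ≤ (a n)⁻¹ := by
      rw [← pow_add]
      calc h n ^ (d + k) ≤ (a n ^ (-ε)) ^ (d + k) := pow_le_pow_left₀ (hh n).le (hha n).le _
        _ = a n ^ (-ε * (d + k : ℕ)) := by
            rw [Real.rpow_mul (ha n).le, Real.rpow_natCast]
        _ ≤ a n ^ (-1 : ℝ) := by
            refine Real.rpow_le_rpow_of_exponent_le hn ?_
            have : 1 < ε * k := by
              rwa [inv_lt_iff_one_lt_mul₀ hε, mul_comm] at hk
            have h2 : 0 ≤ ε * d := by positivity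
            push_cast
            nlinarith
        _ = (a n)⁻¹ := Real.rpow_neg_one _
    rwa [mul_inv, ← div_eq_mul_inv, le_div_iff₀ hpd, mul_comm]

end Model

/-! ### Assembly of the forest estimator -/

theorem forestEstimator_eq {M : ℕ} {F : Type*} (a : ℝ) (z : Space d → F) (W : Set (Space d))
    (π : Fin M → Set (Set F)) (x : Space d) (ξ : PointConfiguration d) :
    forestEstimator a z W π x ξ = (∑ i, relativeCount a ξ (spatialCell z W (π i) x)) / M := rfl

theorem spatialCell_binary {z : Space d → ℝ} {x : Space d} (W : Set (Space d))
    (hx : z x = 0 ∨ z x = 1) :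
    spatialCell z W {{0}, {1}} x = z ⁻¹' {z x} ∩ W := by
  have h : partitionCell ({{0}, {1}} : Set (Set ℝ)) (z x) = {z x} := by
    ext y
    constructor
    · rintro ⟨I, ⟨hI, hxI⟩, hy⟩
      rcases hI with rfl | rfl <;> rw [Set.mem_singleton_iff.1 hxI] <;> exact hy
    · rintro rfl
      rcases hx with hx | hx <;> rw [hx]
      · exact ⟨{0}, ⟨Or.inl rfl, rfl⟩, rfl⟩
      · exact ⟨{1}, ⟨Or.inr rfl, rfl⟩, rfl⟩
  rw [spatialCell, h]

theorem measurable_relativeCount_comp {Ω : Type*} [MeasurableSpace Ω] (a : ℝ)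
    {W : Set (Space d)} (hWb : Bornology.IsBounded W)
    (hWm : MeasurableSet W) {A : Tessellation d → Set (Space d)} (hAW : ∀ t, A t ⊆ W)
    (hA : MeasurableSet {p : Tessellation d × Space d | p.2 ∈ A p.1})
    {X : Ω → PointConfiguration d} (hX : Measurable X) {T : Ω → Tessellation d}
    (hT : Measurable T) : Measurable fun ω => relativeCount a (X ω) (A (T ω)) := by
  have h := (measurable_relativeCount a hWb hWm hAW hA).comp (hX.prodMk hT)
  exact h

theorem measurable_relativeCount_const (a : ℝ) {A : Set (Space d)} (hAm : MeasurableSet A)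
    (hAb : Bornology.IsBounded A) :
    Measurable fun ξ : PointConfiguration d => relativeCount a ξ A := by
  have hm := (measurable_encard_inter hAm).ennreal_toReal
  have e : ∀ ξ : PointConfiguration d, ((ξ.points ∩ A).encard : ℝ≥0∞).toReal
      = ((ξ.points ∩ A).ncard : ℝ) := by
    intro ξ
    rw [← (ξ.locallyFinite A hAb).cast_ncard_eq]
    simp
  simp_rw [e] at hm
  exact hm.div_const _

theorem mean_sq_error_le_of_forall {Ω : Type*} [MeasurableSpace Ω] {P : Measure Ω} {M : ℕ}
    (hM : 1 ≤ M) {y : Fin M → Ω → ℝ} (hy : ∀ i, Measurable (y i)) {l q : ℝ} (hq : 0 ≤ q)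
    {C : Fin M → ℝ} (hC : ∀ i, 0 ≤ C i)
    (h : ∀ i, ∫⁻ ω, ENNReal.ofReal ((y i ω - l) ^ 2) ∂P ≤ ENNReal.ofReal (C i * q)) :
    Integrable (fun ω => ((∑ i, y i ω) / M - l) ^ 2) P ∧
      ∫ ω, ((∑ i, y i ω) / M - l) ^ 2 ∂P ≤ (∑ i, C i) * q := by
  refine integrable_and_integral_le_of_lintegral_sq_le ?_
    (mul_nonneg (Finset.sum_nonneg fun i _ => hC i) hq) ?_
  · exact ((Finset.measurable_fun_sum _ fun i _ => hy i).div_const _).sub_const _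
  calc ∫⁻ ω, ENNReal.ofReal (((∑ i, y i ω) / M - l) ^ 2) ∂P
      ≤ ∫⁻ ω, ∑ i, ENNReal.ofReal ((y i ω - l) ^ 2) ∂P := by
        refine lintegral_mono fun ω => ?_
        rw [← ENNReal.ofReal_sum_of_nonneg fun i _ => sq_nonneg _]
        exact ENNReal.ofReal_le_ofReal (sq_mean_sub_le hM _ _)
    _ = ∑ i, ∫⁻ ω, ENNReal.ofReal ((y i ω - l) ^ 2) ∂P :=
        lintegral_finsetSum _ fun i _ => (((hy i).sub_const _).pow_const 2).ennreal_ofReal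
    _ ≤ ∑ i, ENNReal.ofReal (C i * q) := Finset.sum_le_sum fun i _ => h i
    _ = ENNReal.ofReal ((∑ i, C i) * q) := by
        rw [Finset.sum_mul, ENNReal.ofReal_sum_of_nonneg]
        exact fun i _ => mul_nonneg (hC i) hq

theorem relativeCount_sq_error_le {Ω : Type*} [MeasurableSpace Ω] {P : Measure Ω}
    [IsProbabilityMeasure P] {X : Ω → PointConfiguration d} {lam : Space d → ℝ}
    (hlam : Measurable lam) (h0 : ∀ u, 0 ≤ lam u) {a K c : ℝ} (ha : 0 < a) (hc : 0 < c)
    (hK : ∀ u, lam u ≤ K) (hint : HasIntensityFunction P X fun u => a * lam u)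
    (hX : Measurable X) {g : Space d × Space d → ℝ}
    (hg : HasPairCorrelation P X (fun u => a * lam u) g)
    {A : Set (Space d)} (hA : MeasurableSet A) (hAb : Bornology.IsBounded A)
    (hgA : ENNReal.ofReal a * ∫⁻ p in A ×ˢ A, ENNReal.ofReal |g p - 1|
      ≤ ENNReal.ofReal c * volume A) (hv : 0 < volume.real A)
    {l : ℝ} (hl : 0 ≤ l) (hlA : ∀ u ∈ A, lam u = l) :
    Integrable (fun ω => (relativeCount a (X ω) A - l) ^ 2) P ∧
      ∫ ω, (relativeCount a (X ω) A - l) ^ 2 ∂P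
        ≤ (K + K ^ 2 * c + 1) * (a * volume.real A)⁻¹ := by
  have hK0 : 0 ≤ K := (h0 0).trans (hK 0)
  refine integrable_and_integral_le_of_lintegral_sq_le
    (((measurable_relativeCount_const a hA hAb).comp hX).sub_const _) (by positivity) ?_
  refine (mse_bound hlam h0 ha hc hK hint hX hg hA hAb hgA hl (b := 0)
    (fun u hu => by rw [hlA u hu]; simp) le_rfl).trans_eq ?_
  have hvf : volume A = ENNReal.ofReal (volume.real A) :=
    (ENNReal.ofReal_toReal hAb.measure_lt_top.ne).symm
  rw [hvf, ← ENNReal.ofReal_mul ha.le, ← ENNReal.ofReal_inv_of_pos (by positivity),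
    ← ENNReal.ofReal_mul (by positivity), zero_pow two_ne_zero, ENNReal.ofReal_zero, add_zero]

end SpatialForest

/-! ### The main theorem -/

open SpatialForest
theorem mainTheorem4 {d M : ℕ} (hd : 1 ≤ d) (hM : 1 ≤ M)
    {Ω : ℕ → Type*} [∀ n, MeasurableSpace (Ω n)]
    (P : ∀ n, Measure (Ω n)) [∀ n, IsProbabilityMeasure (P n)]
    -- the observation windows, the normalisation and the point of interest
    (W : ℕ → Set (Space d)) (hWm : ∀ n, MeasurableSet (W n))
    (hWb : ∀ n, Bornology.IsBounded (W n))
    (a : ℕ → ℝ) (ha : ∀ n, 0 < a n) (x : Space d)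
    -- the covariate `z` and the link function `f`, with `λ = f ∘ z`
    (z : Space d → ℝ) (hz : Measurable z)
    (f : ℝ → ℝ) (hf : Measurable f) (hf0 : ∀ y, 0 ≤ f y) (hfb : ∃ K, ∀ y, f y ≤ K)
    (hfc : ContinuousAt f (z x))
    (hfH : ∃ β : ℝ, 0 < β ∧
      (fun y => f y - f (z x)) =O[𝓝 (z x)] (fun y => ‖y - z x‖ ^ β))
    -- the point processes, their intensities and their pair correlation functions
    (X : ∀ n, Ω n → PointConfiguration d) (hX : ∀ n, Measurable (X n))
    (hint : ∀ n, HasIntensityFunction (P n) (X n) (fun u => a n * f (z u)))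
    (g : ℕ → Space d × Space d → ℝ)
    (hg : ∀ n, HasPairCorrelation (P n) (X n) (fun u => a n * f (z u)) (g n))
    (hgn : ∃ c : ℝ, 0 < c ∧ ∀ n, ∀ A ⊆ W n, MeasurableSet A →
      ENNReal.ofReal (a n) * ∫⁻ p in A ×ˢ A, ENNReal.ofReal |g n p - 1|
        ≤ ENNReal.ofReal c * volume A)
    -- `z` is binary, continuous at `x`, and its level set through `x` is not too small
    (hbin : ∀ n, z '' W n = {0, 1}) (hzx : ∀ n, z x ∈ z '' W n) (hzc : ContinuousAt z x)
    (hvol : ∃ c : ℝ, 0 < c ∧ ∀ n, c * volume.real (W n) < volume.real (z ⁻¹' {z x} ∩ W n)) :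
    -- partitions of `W n` by tessellations
    (∀ {Ω₁ : Type*} [MeasurableSpace Ω₁] (P₁ : Measure Ω₁) [IsProbabilityMeasure P₁]
        (T₁ : Ω₁ → Tessellation d) (h : ℕ → ℝ) (T : ∀ n, Fin M → Ω n → Tessellation d)
        (part : Tessellation d → Set (Space d) → Set (Set (Space d))),
      -- `x` is interior to the windows, uniformly in `n`
      (∃ r : ℝ, 0 < r ∧ ∀ n, Metric.ball x r ⊆ W n) →
      -- the model at intensity one
      Measurable T₁ → IsStationaryTessellation P₁ T₁ → tessellationIntensity P₁ T₁ = 1 →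
      -- regular stationary tessellations of intensity `(h n)⁻ᵈ` having the scaling property
      (∀ n, 0 < h n) →
      (∀ n i, Measurable (T n i)) →
      (∀ n i, IsStationaryTessellation (P n) (T n i)) →
      (∀ n i, tessellationIntensity (P n) (T n i) = ENNReal.ofReal (h n ^ (-(d : ℝ)))) →
      (∀ n i, HasScalingProperty (P n) (T n i) (h n ^ (-(d : ℝ))) P₁ T₁) →
      (∀ n i, IsRegularTessellation (P n) (T n i)) →
      -- i.i.d., and independent of the point process
      (∀ n, iIndepFun (fun i => T n i) (P n)) →
      (∀ n i j, IdentDistrib (T n i) (T n j) (P n) (P n)) →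
      (∀ n, IndepFun (X n) (fun ω i => T n i ω) (P n)) →
      -- the induced partitions of `W n`: whole cells or connected subcells
      (part = windowCells ∨ part = windowSubcells) →
      (∀ n, MeasurableSet
        {p : Tessellation d × Space d | p.2 ∈ partitionCell (part p.1 (W n)) x}) →
      -- the cell at `x` shrinks in probability, and its mean inverse content vanishes
      (∀ i, ∀ δ : ℝ, 0 < δ → Tendsto
        (fun n => P n {ω | δ ≤ Metric.diam (partitionCell (part (T n i ω) (W n)) x)})
        atTop (𝓝 0)) →
      (∀ i, Tendsto
        (fun n => ∫⁻ ω, (ENNReal.ofReal (a n) *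
          volume (spatialCell id (W n) (part (T n i ω) (W n)) x))⁻¹ ∂(P n))
        atTop (𝓝 0)) →
      (∃ ε : ℝ, 0 < ε ∧ ∀ n, h n < a n ^ (-ε)) →
      ∃ c : ℝ, 0 < c ∧ ∀ n,
        Integrable (fun ω => (forestEstimator (a n) id (W n)
          (fun i => part (T n i ω) (W n)) x (X n ω) - f (z x)) ^ 2) (P n) ∧
        ∫ ω, (forestEstimator (a n) id (W n)
          (fun i => part (T n i ω) (W n)) x (X n ω) - f (z x)) ^ 2 ∂(P n)
          ≤ c / (a n * h n ^ d)) ∧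
    -- the simple partition of `z(W n)` into its two values
    (∃ c : ℝ, 0 < c ∧ ∀ n,
      Integrable (fun ω => (forestEstimator (a n) z (W n)
        (fun _ : Fin M => {{0}, {1}}) x (X n ω) - f (z x)) ^ 2) (P n) ∧
      ∫ ω, (forestEstimator (a n) z (W n)
        (fun _ : Fin M => {{0}, {1}}) x (X n ω) - f (z x)) ^ 2 ∂(P n)
        ≤ c / (a n * volume.real (W n))) := by
  obtain ⟨K, hK⟩ := hfb
  obtain ⟨c, hc, hgc⟩ := hgn
  have hlam : Measurable fun u => f (z u) := hf.comp hz
  have hK0 : 0 ≤ K := (hf0 0).trans (hK 0)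
  have hC1 : 0 ≤ K + K ^ 2 * c + 1 := by positivity
  have hM0 : (M : ℝ) ≠ 0 := by positivity
  constructor
  · intro Ω₁ _ P₁ _ T₁ h T part hball hT₁ hst₁ hγ₁ hh hT hst hγ hsc hreg _ _ hind hpart hmeas
      hdiam hinv hε
    obtain ⟨r, hr, hrW⟩ := hball
    obtain ⟨ε, hε, hha⟩ := hε
    obtain ⟨r', hr', hz'⟩ := exists_ball_eq_of_binary hr (hrW 0) (hbin 0) hzc
    have hcell : ∀ n t, spatialCell id (W n) (part t (W n)) x = partitionCell (part t (W n)) x := by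
      intro n t
      exact Set.inter_eq_left.2 fun u hu => (exists_cell_of_mem_partitionCell hpart hu).1
    simp_rw [forestEstimator_eq, hcell] at hinv ⊢
    have hW : ∀ n t, partitionCell (part t (W n)) x ⊆ W n := fun n t u hu =>
      (exists_cell_of_mem_partitionCell hpart hu).1
    have hlow : ∀ n (t : Tessellation d), ∀ C : NonemptyCompacts (Space d), C ∈ t.cells → x ∈ C →
        (C : Set (Space d)) ∩ Metric.ball x r ⊆ partitionCell (part t (W n)) x :=
      fun n t C hC hx => inter_ball_subset_partitionCell hpart hr (hrW n) hC hx
    have hup : ∀ n t, ∀ u ∈ partitionCell (part t (W n)) x, ∃ C ∈ t.cells, x ∈ C ∧ u ∈ C :=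
      fun n t u hu => (exists_cell_of_mem_partitionCell hpart hu).2
    have hxA : ∀ n t, x ∈ partitionCell (part t (W n)) x := by
      intro n t
      obtain ⟨C, hC, hx⟩ := t.cover x
      exact hlow n t C hC hx ⟨hx, Metric.mem_ball_self hr⟩
    have hvolm : ∀ n, Measurable fun t => volume (partitionCell (part t (W n)) x) := fun n =>
      measurable_measure_prodMk_left (hmeas n)
    have ha1 : ∀ᶠ n in atTop, 1 ≤ a n :=
      -- The conclusion on `a` does not involve the trees, so any one of them will do.
      eventually_one_le (A := fun n ω => partitionCell (part (T n ⟨0, hM⟩ ω) (W n)) x)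
        (fun n => (hvolm n).comp (hT n _)) (fun n ω => (hWb n).subset (hW n _))
        (fun n ω => hxA n _) (hdiam _ 1 one_pos) (hinv _)
    -- Eventually `h n < a n ^ (-ε) ≤ 1`; the finitely many earlier terms are absorbed by their sum.
    have hhb : BddAbove (Set.range h) := by
      obtain ⟨N, hN⟩ := eventually_atTop.1 ha1
      refine ⟨1 + ∑ n ∈ Finset.range N, h n, ?_⟩
      rintro _ ⟨n, rfl⟩
      have hs : 0 ≤ ∑ n ∈ Finset.range N, h n := Finset.sum_nonneg fun n _ => (hh n).le
      by_cases hn : N ≤ n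
      · have := (hha n).le.trans (Real.rpow_le_one_of_one_le_of_nonpos (hN n hn) (by linarith))
        linarith
      · have := Finset.single_le_sum (f := h) (fun n _ => (hh n).le)
          (Finset.mem_range.2 (not_le.1 hn))
        linarith
    have htree : ∀ i : Fin M, ∃ C : ℝ, 0 ≤ C ∧ ∀ n,
        ∫⁻ ω, ENNReal.ofReal ((relativeCount (a n) (X n ω)
          (partitionCell (part (T n i ω) (W n)) x) - f (z x)) ^ 2) ∂(P n)
          ≤ ENNReal.ofReal (C * (a n * h n ^ d)⁻¹) := by
      intro i
      obtain ⟨C₁, hC₁, h₁⟩ := exists_inverse_content_bound hd ha hh hhb hT₁ hst₁ hγ₁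
        (fun n => hT n i) (fun n => hst n i) (fun n => hγ n i) (fun n => hsc n i) hWb hr
        (A := fun n t => partitionCell (part t (W n)) x) hW hlow hup (hinv i)
      obtain ⟨C₂, hC₂, h₂⟩ := exists_escape_bound hd ha ha1 hh hε hha hT₁ hst₁ hγ₁
        (fun n => hT n i) (fun n => hst n i) (fun n => hγ n i) (fun n => hsc n i) (hreg 0 i) hr'
        (A := fun n t => partitionCell (part t (W n)) x) hup
      refine ⟨(K + K ^ 2 * c + 1) * C₁ + K ^ 2 * C₂, by positivity, fun n => ?_⟩
      have hind' : IndepFun (X n) (T n i) (P n) :=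
        (hind n).comp measurable_id (measurable_pi_apply i)
      have hq : 0 ≤ (a n * h n ^ d)⁻¹ := (inv_pos.2 (mul_pos (ha n) (pow_pos (hh n) d))).le
      refine (tree_mse_le hlam (fun u => hf0 _) (ha n) hc (fun u => hK _) (hint n) (hX n) (hg n)
        (hWb n) (hWm n) (hgc n) (hT n i) hind' (hW n) (hmeas n)
        (fun u hu => by rw [hz' u hu])).trans ?_
      refine (add_le_add (mul_le_mul_right (h₁ n) _) (mul_le_mul_right (h₂ n) _)).trans_eq ?_
      rw [← ENNReal.ofReal_mul hC1, ← ENNReal.ofReal_mul (by positivity),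
        ← ENNReal.ofReal_add (by positivity) (by positivity)]
      congr 1; ring
    choose C hC hCn using htree
    have hS : 0 ≤ ∑ i, C i := Finset.sum_nonneg fun i _ => hC i
    -- The constants `C i` may all vanish; adding one makes the constant positive.
    refine ⟨∑ i, C i + 1, by positivity, fun n => ?_⟩
    have hq : 0 < a n * h n ^ d := mul_pos (ha n) (pow_pos (hh n) d)
    have htm : ∀ i, Measurable fun ω => relativeCount (a n) (X n ω)
        (partitionCell (part (T n i ω) (W n)) x) := by
      intro i
      exact measurable_relativeCount_comp (a n) (hWb n) (hWm n)
        (A := fun t => partitionCell (part t (W n)) x) (hW n) (hmeas n) (hX n) (hT n i)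
    obtain ⟨hint', hle⟩ := mean_sq_error_le_of_forall hM htm (inv_pos.2 hq).le hC
      fun i => hCn i n
    refine ⟨hint', hle.trans ?_⟩
    rw [div_eq_mul_inv]
    exact mul_le_mul_of_nonneg_right (by linarith) (inv_pos.2 hq).le
  · obtain ⟨c₀, hc₀, hvol⟩ := hvol
    have hx : z x = 0 ∨ z x = 1 := by
      have := hzx 0
      rw [hbin 0] at this
      simpa using this
    -- The factor `c₀⁻¹` comes from replacing the volume of the level set by that of the window.
    refine ⟨(K + K ^ 2 * c + 1) * c₀⁻¹, by positivity, fun n => ?_⟩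
    simp_rw [forestEstimator_eq, spatialCell_binary (W n) hx]
    set A := z ⁻¹' {z x} ∩ W n with hA
    have hAm : MeasurableSet A := (hz (measurableSet_singleton _)).inter (hWm n)
    have hAb : Bornology.IsBounded A := (hWb n).subset Set.inter_subset_right
    have hvA : 0 < volume.real A := (mul_nonneg hc₀.le measureReal_nonneg).trans_lt (hvol n)
    have hvW : 0 < volume.real (W n) :=
      hvA.trans_le (measureReal_mono Set.inter_subset_right (hWb n).measure_lt_top.ne)
    have hmean : ∀ ω, (∑ _i : Fin M, relativeCount (a n) (X n ω) A) / M
        = relativeCount (a n) (X n ω) A := by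
      intro ω
      rw [Finset.sum_const, Finset.card_univ, Fintype.card_fin, nsmul_eq_mul,
        mul_div_cancel_left₀ _ hM0]
    simp_rw [hmean]
    have hlA : ∀ u ∈ A, f (z u) = f (z x) := fun u hu => congrArg f hu.1
    obtain ⟨h₁, h₂⟩ := relativeCount_sq_error_le hlam (fun u => hf0 _) (ha n) hc (fun u => hK _)
      (hint n) (hX n) (hg n) hAm hAb (hgc n A Set.inter_subset_right hAm) hvA (hf0 (z x)) hlA
    refine ⟨h₁, h₂.trans ?_⟩
    rw [div_eq_mul_inv, mul_assoc, ← mul_inv]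
    refine mul_le_mul_of_nonneg_left (inv_anti₀
      (mul_pos hc₀ (mul_pos (ha n) hvW)) ?_) hC1
    calc c₀ * (a n * volume.real (W n)) = a n * (c₀ * volume.real (W n)) := by ring
      _ ≤ a n * volume.real A := mul_le_mul_of_nonneg_left (hvol n).le (ha n).le
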